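/- Let $N\ge 1$, let $K$ be a field and let $q,q_0,q_N,s,\zeta_0,\zeta_N,\kappa_N\in K^{\times}$. Put $q_i:=q$ for $1\le i\le N-1$. *Operators.* On functions of $\mathbf z=(z_1,\dots,z_N)$ let $(s_if)(\mathbf z)=f(s_i\mathbf z)$, where $s_0\mathbf z=(s^2z_1^{-1},z_2,\dots,z_N)$, $s_i$ exchanges $z_i$ and $z_{i+1}$ for $1\le i\le N-1$, and $s_N\mathbf z=(z_1,\dots,z_{N-1},z_N^{-1})$. On $K(z_1,\dots,z_N)\supset K[z_1^{\pm1},\dots,z_N^{\pm1}]$ define $$\hat T_0=-q_0-q_0^{-1}\frac{(1-sq_0\zeta_0^{-1}z_1^{-1})(1+sq_0\zeta_0z_1^{-1})}{1-s^2z_1^{-2}}(s_0-1),\qquad \hat T_i=-q-q^{-1}\frac{1-q^2z_iz_{i+1}^{-1}}{1-z_iz_{i+1}^{-1}}(s_i-1)\quad(1\le i\le N-1),$$ $$\hat T_N=-q_N-q_N^{-1}\frac{(1+q_N\zeta_Nz_N)(1-q_N\zeta_N^{-1}z_N)}{1-z_N^2}(s_N-1),$$ which are invertible, and $$\hat Y_i=\hat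 T_i\hat T_{i+1}\cdots\hat T_{N-1}\,\hat T_N\hat T_{N-1}\cdots\hat T_1\hat T_0\,\hat T_1^{-1}\cdots\hat T_{i-1}^{-1}\qquad(1\le i\le N).$$ *Matrices.* Let $V$ have the ordered basis $(v_+,v_-)$, and for $\epsilon\in\{+,-\}^N$ put $v_\epsilon=v_{\epsilon_1}\otimes\cdots\otimes v_{\epsilon_N}\in V^{\otimes N}$. For $1\le i\le N-1$ let $e_i$ act on the tensor factors $i,i+1$ of $V^{\otimes N}$ (basis $v_{++},v_{+-},v_{-+},v_{--}$), and let $e_N$ act on the last factor, by $$e_i=\begin{pmatrix}0&0&0&0\\0&-q^{-1}&1&0\\0&1&-q&0\\0&0&0&0\end{pmatrix},\qquad e_N=\begin{pmatrix}-q_N^{-1}&\kappa_N\\ \kappa_N^{-1}&-q_N\end{pmatrix}.$$ Put $\check R_i(x)=\frac{qx-q^{-1}}{q-q^{-1}x}+\frac{x-1}{q-q^{-1}x}e_i$ and $K_N(x)=\frac{(x+q_N\zeta_N)(x-q_N\zeta_N^{-1})+q_N(x^2-1)e_N}{(1+q_N\zeta_Nx)(1-q_N\zeta_N^{-1}x)}$.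 *Kazhdan--Lusztig basis (type BII).* Let $\mathcal B_N$ be the set of strings $b\in\{+,-\}^N$ all of whose partial sums $b_1+\dots+b_j$, $1\le j\le N$, are $\le 0$. In $b$, join each adjacent pair $-+$ (in this order) by an arc and repeat, ignoring letters already joined, until no such pair remains; for $b\in\mathcal B_N$ the unjoined letters are all $-$. Let $C_b\in V^{\otimes N}$ be the tensor product in which an arc contributes $v_{-+}-q^{-1}v_{+-}$ at its two end points, and the $m$-th unjoined $-$, counted from the right, contributes $v_--\kappa_Nq_N^{-1}v_+$ if $m$ is odd and $v_-+\kappa_Nq^{-1}q_Nv_+$ if $m$ is even. *Equation.* Let $\Psi(\mathbf z)=\sum_{b\in\mathcal B_N}\Psi_b(\mathbf z)C_b$ with $\Psi_b\in K(z_1,\dots,z_N)$ (for instance, Laurent polynomials) be a solution of the one-boundary qKZ equation $$\Psi(s_0\mathbf z)=\Psi(\mathbf z),\qquad \Psi(s_i\mathbf z)=\check R_i(z_{i+1}/z_i)\Psi(\mathbf z)\ (1\le i\le N-1),\qquad \Psi(s_N\mathbf z)=K_N(z_N)\Psi(\mathbf z).$$ Let $\Psi_0:=\Psi_{b_0}$,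 where $b_0$ consists of $\lfloor (N+1)/2\rfloor$ letters $-$ followed by $\lfloor N/2\rfloor$ letters $+$. For $N$ odd let $\Psi_{(N+1)/2}$ be the component of $\Psi$ at the string of $(N-1)/2$ letters $-$, then $(N-1)/2$ letters $+$, then one letter $-$. **Proposition.** If $N$ is odd, then $$\hat Y_i\Psi_0=\begin{cases}q^{-(N+1-2i)}q_0q_N\Psi_0,&1\le i\le (N+1)/2,\\-q^{-2(N-i)}q_0q_N^{-1}\Psi_0,&(N+3)/2\le i\le N,\end{cases}$$ $$\hat Y_i\Psi_{(N+1)/2}=\begin{cases}-q^{-(N-1-2i)}q_0q_N^{-1}\Psi_{(N+1)/2},&1\le i\le (N-1)/2,\\q^{-2(N-i)}q_0q_N\Psi_{(N+1)/2},&(N+1)/2\le i\le N.\end{cases}$$ If $N$ is even, then $$\hat Y_i\Psi_0=\begin{cases}q^{-(N-2i)}q_0q_N\Psi_0,&1\le i\le N/2,\\-q^{-2(N-i)}q_0q_N^{-1}\Psi_0,&N/2+1\le i\le N.\end{cases}$$ -/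

import Mathlib

namespace OneBoundaryQKZ

/-- The parameters of the one-boundary qKZ equation: the Hecke parameters `q`, `q₀`, `q_N`, the
shift parameter `s`, the Baxterization parameters `ζ₀`, `ζ_N`, and `κ_N`. They are arbitrary
nonzero elements of a field `K`, so generic and specialized parameters are both covered. -/
structure Params (K : Type*) [Field K] where
  q : Kˣ
  q0 : Kˣ
  qN : Kˣ
  s : Kˣ
  ζ0 : Kˣ
  ζN : Kˣ
  κN : Kˣ

/-! ### Laurent polynomials, rational functions and the affine Weyl group action -/

/-- The Laurent polynomial ring `K[z₁^{±1}, …, z_N^{±1}]`; the exponent vectors are the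
elements of `ℤ^N`. -/
abbrev Laurent (K : Type*) [Field K] (N : ℕ) : Type _ := AddMonoidAlgebra K (Fin N → ℤ)

/-- The field of rational functions `K(z₁, …, z_N)`, which contains the Laurent polynomials. -/
abbrev RatFn (K : Type*) [Field K] (N : ℕ) : Type _ := FractionRing (Laurent K N)

/-- The position with number `k`, where `1 ≤ k ≤ N` (positions are numbered from 1). -/
def site (N : ℕ) [NeZero N] (k : ℕ) : Fin N := Fin.ofNat N (k - 1)

section Action

variable {K : Type*} [Field K] {N : ℕ}

/-- The monomial `z_k`, as a unit of the ring of Laurent polynomials. -/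
noncomputable def zUnit (K : Type*) [Field K] {N : ℕ} (k : Fin N) : (Laurent K N)ˣ where
  val := AddMonoidAlgebra.single (Pi.single k 1) 1
  inv := AddMonoidAlgebra.single (-Pi.single k 1) 1
  val_inv := by simp [AddMonoidAlgebra.single_mul_single, AddMonoidAlgebra.one_def]
  inv_val := by simp [AddMonoidAlgebra.single_mul_single, AddMonoidAlgebra.one_def]

/-- A nonzero constant, as a unit of the ring of Laurent polynomials. -/
noncomputable def constUnit (N : ℕ) (a : Kˣ) : (Laurent K N)ˣ :=
  Units.map (algebraMap K (Laurent K N)).toMonoidHom a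

/-- The substitution `z_k ↦ u_k`, as an endomorphism of the ring of Laurent polynomials. -/
noncomputable def subst (u : Fin N → (Laurent K N)ˣ) : Laurent K N →ₐ[K] Laurent K N :=
  AddMonoidAlgebra.lift K (Laurent K N) (Fin N → ℤ)
    { toFun := fun m => ((∏ k, u k ^ (Multiplicative.toAdd m k) : (Laurent K N)ˣ) : Laurent K N)
      map_one' := by simp
      map_mul' := fun a b => by
        rw [← Units.val_mul, ← Finset.prod_mul_distrib]
        simp [zpow_add] }

theorem subst_zUnit (u : Fin N → (Laurent K N)ˣ) (k : Fin N) :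
    subst u (zUnit K k : Laurent K N) = u k := by
  simp only [subst, zUnit, AddMonoidAlgebra.lift_single, one_smul]
  change ((∏ j, u j ^ (Pi.single (M := fun _ => ℤ) k 1 j) : (Laurent K N)ˣ) : Laurent K N) = u k
  congr 1
  rw [Finset.prod_eq_single k]
  · simp
  · intro b _ hb
    simp [hb]
  · simp

theorem single_eq_prod (m : Fin N → ℤ) :
    (AddMonoidAlgebra.single m 1 : Laurent K N)
      = ((∏ k, zUnit K k ^ m k : (Laurent K N)ˣ) : Laurent K N) := by
  let f : Multiplicative (Fin N → ℤ) →* (Laurent K N)ˣ :=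
    { toFun := fun m => ⟨AddMonoidAlgebra.single (Multiplicative.toAdd m) 1,
        AddMonoidAlgebra.single (-Multiplicative.toAdd m) 1,
        by simp [AddMonoidAlgebra.single_mul_single, AddMonoidAlgebra.one_def],
        by simp [AddMonoidAlgebra.single_mul_single, AddMonoidAlgebra.one_def]⟩
      map_one' := by ext1; simp [AddMonoidAlgebra.one_def]
      map_mul' := fun a b => by
        ext1; simp [AddMonoidAlgebra.single_mul_single] }
  have hz : ∀ k, zUnit K k = f (Multiplicative.ofAdd (Pi.single k 1)) := fun k => by
    ext1; rfl
  have hm : f (Multiplicative.ofAdd m) = ∏ k, zUnit K k ^ m k := by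
    simp_rw [hz, ← map_zpow, ← map_prod]
    congr 1
    apply Multiplicative.toAdd.injective
    simp only [toAdd_ofAdd, toAdd_prod, toAdd_zpow]
    ext j
    simp [Finset.sum_apply, Pi.single_apply]
  rw [← hm]
  rfl

theorem algHom_ext_zUnit {f g : Laurent K N →ₐ[K] Laurent K N}
    (h : ∀ k : Fin N, f (zUnit K k : Laurent K N) = g (zUnit K k : Laurent K N)) : f = g := by
  refine AddMonoidAlgebra.algHom_ext (fun m => ?_) (Subsingleton.elim _ _)
  rw [single_eq_prod]
  have hu : ∀ k : Fin N, Units.map (f : Laurent K N →* Laurent K N) (zUnit K k)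
      = Units.map (g : Laurent K N →* Laurent K N) (zUnit K k) := fun k => by
    ext1; exact h k
  have key : Units.map (f : Laurent K N →* Laurent K N) (∏ k, zUnit K k ^ m k)
      = Units.map (g : Laurent K N →* Laurent K N) (∏ k, zUnit K k ^ m k) := by
    simp only [map_prod, map_zpow, hu]
  exact congrArg Units.val key

theorem subst_constUnit (u : Fin N → (Laurent K N)ˣ) (a : Kˣ) :
    Units.map (subst u : Laurent K N →* Laurent K N) (constUnit N a) = constUnit N a := by
  ext1
  exact (subst u).commutes (a : K)

theorem subst_zUnit' (u : Fin N → (Laurent K N)ˣ) (k : Fin N) :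
    Units.map (subst u : Laurent K N →* Laurent K N) (zUnit K k) = u k := by
  ext1
  exact subst_zUnit u k

variable [NeZero N]

/-- The point `s_i 𝐳`, for `0 ≤ i ≤ N`:
`s₀𝐳 = (s²/z₁, z₂, …, z_N)`, `s_N𝐳 = (z₁, …, z_{N-1}, 1/z_N)`, and
`s_i` exchanges `z_i` and `z_{i+1}` for `1 ≤ i ≤ N-1`. -/
noncomputable def reflPoint (p : Params K) (i : ℕ) : Fin N → (Laurent K N)ˣ :=
  if i = 0 then
    Function.update (zUnit K) (site N 1) (constUnit N p.s ^ 2 * (zUnit K (site N 1))⁻¹)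
  else if i < N then
    fun k => zUnit K (Equiv.swap (site N i) (site N (i + 1)) k)
  else
    Function.update (zUnit K) (site N N) (zUnit K (site N N))⁻¹

theorem subst_reflPoint_invol (p : Params K) (i : ℕ) :
    (subst (reflPoint (N := N) p i)).comp (subst (reflPoint p i)) = AlgHom.id K _ := by
  apply algHom_ext_zUnit
  intro k
  simp only [AlgHom.comp_apply, subst_zUnit, AlgHom.id_apply]
  change ((Units.map (subst (reflPoint (N := N) p i) : Laurent K N →* Laurent K N)
    (reflPoint p i k) : (Laurent K N)ˣ) : Laurent K N) = _
  congr 1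
  conv_lhs => arg 2; unfold reflPoint
  split_ifs with h0 hN
  · by_cases hk : k = site N 1
    · subst hk
      simp only [Function.update_self, map_mul, map_pow, map_inv, subst_constUnit, subst_zUnit']
      simp [reflPoint, h0]
    · simp only [Function.update_of_ne hk, subst_zUnit']
      simp [reflPoint, h0, Function.update_of_ne hk]
  · simp only [subst_zUnit']
    simp [reflPoint, h0, hN]
  · by_cases hk : k = site N N
    · subst hk
      simp only [Function.update_self, map_inv, subst_zUnit']
      simp [reflPoint, h0, hN]
    · simp only [Function.update_of_ne hk, subst_zUnit']
      simp [reflPoint, h0, hN, Function.update_of_ne hk]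

/-- `f(𝐳) ↦ f(s_i 𝐳)` on Laurent polynomials. -/
noncomputable def reflLaurent (N : ℕ) [NeZero N] (p : Params K) (i : ℕ) :
    Laurent K N ≃ₐ[K] Laurent K N :=
  AlgEquiv.ofAlgHom (subst (reflPoint (N := N) p i)) (subst (reflPoint p i))
    (subst_reflPoint_invol p i) (subst_reflPoint_invol p i)

/-- `f(𝐳) ↦ f(s_i 𝐳)` on rational functions. -/
noncomputable def refl (p : Params K) (i : ℕ) : RatFn K N ≃ₐ[K] RatFn K N :=
  IsFractionRing.algEquivOfAlgEquiv (reflLaurent N p i)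

/-- The variable `z_k`, `1 ≤ k ≤ N`, as a rational function. -/
noncomputable def z (K : Type*) [Field K] (N : ℕ) [NeZero N] (k : ℕ) : RatFn K N :=
  algebraMap (Laurent K N) (RatFn K N) (zUnit K (site N k))

/-- The constant function with value `a`. -/
noncomputable def const (N : ℕ) (a : Kˣ) : RatFn K N := algebraMap K (RatFn K N) a

theorem const_ne_zero (N : ℕ) (a : Kˣ) : const N a ≠ 0 := by
  simp [const]

theorem refl_algebraMap (p : Params K) (i : ℕ) (a : Laurent K N) :
    refl p i (algebraMap _ (RatFn K N) a)
      = algebraMap (Laurent K N) (RatFn K N) (subst (reflPoint p i) a) :=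
  IsFractionRing.algEquivOfAlgEquiv_algebraMap (reflLaurent N p i) a

theorem refl_const (p : Params K) (i : ℕ) (a : Kˣ) : refl p i (const N a) = const N a :=
  (refl p i).commutes (a : K)

theorem refl_refl (p : Params K) (i : ℕ) (f : RatFn K N) : refl p i (refl p i f) = f := by
  have h : ∀ a : Laurent K N, refl p i (refl p i (algebraMap _ (RatFn K N) a))
      = algebraMap _ (RatFn K N) a := fun a => by
    rw [refl_algebraMap, refl_algebraMap]
    apply congrArg
    exact DFunLike.congr_fun (subst_reflPoint_invol (N := N) p i) a
  obtain ⟨x, y, -, rfl⟩ := IsFractionRing.div_surjective (Laurent K N) f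
  rw [map_div₀, map_div₀, h, h]

theorem refl_z (p : Params K) (i k : ℕ) :
    refl p i (z K N k) = algebraMap (Laurent K N) (RatFn K N) (reflPoint p i (site N k)) := by
  rw [z, refl_algebraMap, subst_zUnit]

theorem z_ne_zero (k : ℕ) : z K N k ≠ 0 := by
  have h := (zUnit K (site N k)).isUnit.map (algebraMap (Laurent K N) (RatFn K N))
  exact h.ne_zero

theorem refl_z_zero (p : Params K) :
    refl p 0 (z K N 1) = const N p.s ^ 2 * (z K N 1)⁻¹ := by
  rw [refl_z, eq_mul_inv_iff_mul_eq₀ (z_ne_zero 1), z, ← map_mul]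
  simp only [reflPoint, if_true, Function.update_self]
  rw [← Units.val_mul, inv_mul_cancel_right, Units.val_pow_eq_pow_val, map_pow]
  apply congrArg (· ^ 2)
  exact (IsScalarTower.algebraMap_apply K (Laurent K N) (RatFn K N) (p.s : K)).symm

theorem refl_z_last (p : Params K) : refl p N (z K N N) = (z K N N)⁻¹ := by
  apply eq_inv_of_mul_eq_one_left
  rw [refl_z, z, ← map_mul]
  simp [reflPoint, NeZero.ne N]

theorem refl_z_left (p : Params K) {i : ℕ} (h0 : i ≠ 0) (hN : i < N) :
    refl p i (z K N i) = z K N (i + 1) := by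
  rw [refl_z]
  simp [reflPoint, h0, hN, z]

theorem refl_z_right (p : Params K) {i : ℕ} (h0 : i ≠ 0) (hN : i < N) :
    refl p i (z K N (i + 1)) = z K N i := by
  rw [refl_z]
  simp [reflPoint, h0, hN, z]

theorem z_injective {k l : ℕ} (hk : k ∈ Finset.Icc 1 N) (hl : l ∈ Finset.Icc 1 N)
    (h : z K N k = z K N l) : k = l := by
  have h1 : (zUnit K (site N k) : Laurent K N) = zUnit K (site N l) :=
    IsFractionRing.injective (Laurent K N) (RatFn K N) h
  have h2 : (Pi.single (site N k) 1 : Fin N → ℤ) = Pi.single (site N l) 1 :=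
    AddMonoidAlgebra.of_injective (R := K) (M := Fin N → ℤ) h1
  have h3 : site N k = site N l := by
    by_contra hne
    have := congrFun h2 (site N k)
    simp [hne] at this
  simp only [Finset.mem_Icc] at hk hl
  have h4 := congrArg Fin.val h3
  simp only [site, Fin.ofNat, Nat.mod_eq_of_lt (show k - 1 < N by omega),
    Nat.mod_eq_of_lt (show l - 1 < N by omega)] at h4
  omega

theorem z_sq_ne_const (k : ℕ) (a : Kˣ) : z K N k ^ 2 ≠ const N a := by
  intro h
  have hc : const N a = algebraMap (Laurent K N) (RatFn K N) (algebraMap K _ (a : K)) :=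
    IsScalarTower.algebraMap_apply K (Laurent K N) (RatFn K N) (a : K)
  rw [hc, z, ← map_pow] at h
  have h1 := IsFractionRing.injective (Laurent K N) (RatFn K N) h
  simp only [zUnit, AddMonoidAlgebra.single_pow, one_pow, AddMonoidAlgebra.coe_algebraMap,
    Function.comp_apply, Algebra.algebraMap_self, RingHom.id_apply] at h1
  have h2 := congrArg (fun f : Laurent K N => f.coeff (2 • Pi.single (site N k) 1)) h1
  have h3 : (2 • Pi.single (site N k) 1 : Fin N → ℤ) ≠ 0 := fun h => by
    simpa using congrFun h (site N k)
  simp only [AddMonoidAlgebra.coeff_single, Finsupp.single_apply, if_neg h3.symm, if_true] at h2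
  exact one_ne_zero h2

end Action

/-! ### The operators `T̂_i` and `Ŷ_i` -/

section Hecke

variable {K : Type*} [Field K] {N : ℕ} [NeZero N]

/-- The Hecke parameter `q_i`: `q₀` for `i = 0`, `q` for `1 ≤ i ≤ N-1`, and `q_N` for `i = N`. -/
def Params.hecke (p : Params K) (N i : ℕ) : Kˣ :=
  if i = 0 then p.q0 else if i < N then p.q else p.qN

/-- The rational function in front of `s_i - 1` in `-T̂_i - q_i`. -/
noncomputable def coeffT (p : Params K) (N : ℕ) [NeZero N] (i : ℕ) : RatFn K N :=
  let c := const (K := K) N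
  if i = 0 then
    (c p.q0)⁻¹ * ((1 - c p.s * c p.q0 * (c p.ζ0)⁻¹ * (z K N 1)⁻¹)
        * (1 + c p.s * c p.q0 * c p.ζ0 * (z K N 1)⁻¹))
      / (1 - c p.s ^ 2 * (z K N 1)⁻¹ ^ 2)
  else if i < N then
    (c p.q)⁻¹ * (1 - c p.q ^ 2 * (z K N i / z K N (i + 1))) / (1 - z K N i / z K N (i + 1))
  else
    (c p.qN)⁻¹ * ((1 + c p.qN * c p.ζN * z K N N) * (1 - c p.qN * (c p.ζN)⁻¹ * z K N N))
      / (1 - z K N N ^ 2)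

/-- The operator `T̂_i = -q_i - coeffT_i (s_i - 1)`, `0 ≤ i ≤ N`. -/
noncomputable def That (p : Params K) (N : ℕ) [NeZero N] (i : ℕ) : Module.End K (RatFn K N) :=
  -((p.hecke N i : K) • LinearMap.id)
    - LinearMap.mulLeft K (coeffT p N i) ∘ₗ ((refl p i).toLinearMap - LinearMap.id)

/-- The inverse of `T̂_i`; see `That_mul_ThatInv` and `ThatInv_mul_That`. -/
noncomputable def ThatInv (p : Params K) (N : ℕ) [NeZero N] (i : ℕ) : Module.End K (RatFn K N) :=
  That p N i + ((p.hecke N i : K) - (p.hecke N i : K)⁻¹) • LinearMap.id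

theorem coeff_identity_right {F : Type*} [Field F] {q ζ x : F} (hq : q ≠ 0) (hζ : ζ ≠ 0)
    (hx : x ≠ 0) (h : x ^ 2 ≠ 1) :
    q⁻¹ * ((1 + q * ζ * x) * (1 - q * ζ⁻¹ * x)) / (1 - x ^ 2)
      + q⁻¹ * ((1 + q * ζ * x⁻¹) * (1 - q * ζ⁻¹ * x⁻¹)) / (1 - x⁻¹ ^ 2) = q + q⁻¹ := by
  have h1 : 1 - x ^ 2 ≠ 0 := sub_ne_zero.2 (Ne.symm h)
  have e : 1 - x⁻¹ ^ 2 = -(1 - x ^ 2) / x ^ 2 := by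
    field_simp
    ring
  rw [e]
  field_simp
  ring

theorem coeff_identity_bulk {F : Type*} [Field F] {q x y : F} (hq : q ≠ 0) (hx : x ≠ 0)
    (hy : y ≠ 0) (h : y - x ≠ 0) :
    q⁻¹ * (1 - q ^ 2 * (x / y)) / (1 - x / y)
      + q⁻¹ * (1 - q ^ 2 * (y / x)) / (1 - y / x) = q + q⁻¹ := by
  have e1 : 1 - x / y = (y - x) / y := by field_simp
  have e2 : 1 - y / x = -(y - x) / x := by
    field_simp
    ring
  rw [e1, e2]
  field_simp
  ring

theorem coeff_identity_left {F : Type*} [Field F] {q ζ s x : F} (hq : q ≠ 0) (hζ : ζ ≠ 0)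
    (hs : s ≠ 0) (hx : x ≠ 0) (h : x ^ 2 ≠ s ^ 2) :
    q⁻¹ * ((1 - s * q * ζ⁻¹ * x⁻¹) * (1 + s * q * ζ * x⁻¹)) / (1 - s ^ 2 * x⁻¹ ^ 2)
      + q⁻¹ * ((1 - s * q * ζ⁻¹ * (s ^ 2 * x⁻¹)⁻¹) * (1 + s * q * ζ * (s ^ 2 * x⁻¹)⁻¹))
        / (1 - s ^ 2 * (s ^ 2 * x⁻¹)⁻¹ ^ 2) = q + q⁻¹ := by
  have h1 : x * s⁻¹ ≠ 0 := by positivity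
  have h2 : (s * x⁻¹) ^ 2 ≠ 1 := by
    intro h'
    apply h
    field_simp at h'
    exact h'.symm
  have := coeff_identity_right (x := s * x⁻¹) hq hζ (by positivity) h2
  rw [← this]
  congr 2
  · ring
  · ring
  · field_simp
  · field_simp

theorem coeffT_add_refl (p : Params K) {i : ℕ} (hi : i ≤ N) :
    coeffT p N i + refl p i (coeffT p N i)
      = const N (p.hecke N i) + (const N (p.hecke N i))⁻¹ := by
  have hz := z_ne_zero (K := K) (N := N)
  have hc := const_ne_zero (K := K) N
  by_cases h0 : i = 0
  · subst h0
    have h1 := z_sq_ne_const (K := K) (N := N) 1 (p.s ^ 2)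
    simp only [coeffT, Params.hecke, if_true, map_div₀, map_mul, map_add, map_sub, map_one,
      map_inv₀, map_pow, refl_const, refl_z_zero]
    exact coeff_identity_left (hc _) (hc _) (hc _) (hz 1) (by simpa [const] using h1)
  · by_cases hN : i < N
    · have h1 : z K N (i + 1) - z K N i ≠ 0 := by
        rw [sub_ne_zero]
        intro h
        have := z_injective (by simp; omega) (by simp; omega) h
        omega
      simp only [coeffT, Params.hecke, h0, hN, if_true, if_false, map_div₀, map_mul, map_sub,
        map_one, map_inv₀, map_pow, refl_const, refl_z_left p h0 hN, refl_z_right p h0 hN]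
      exact coeff_identity_bulk (hc _) (hz _) (hz _) h1
    · obtain rfl : i = N := by omega
      have h1 := z_sq_ne_const (K := K) (N := i) i 1
      simp only [coeffT, Params.hecke, h0, lt_irrefl, if_false, map_div₀, map_mul, map_add,
        map_sub, map_one, map_inv₀, map_pow, refl_const, refl_z_last]
      exact coeff_identity_right (hc _) (hc _) (hz _) (by simpa [const] using h1)

theorem That_apply (p : Params K) (i : ℕ) (f : RatFn K N) :
    That p N i f = -(const N (p.hecke N i) * f) - coeffT p N i * (refl p i f - f) := by
  simp [That, const, Algebra.smul_def]

theorem ThatInv_apply (p : Params K) (i : ℕ) (f : RatFn K N) :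
    ThatInv p N i f
      = -((const N (p.hecke N i))⁻¹ * f) - coeffT p N i * (refl p i f - f) := by
  simp only [ThatInv, LinearMap.add_apply, That_apply, LinearMap.smul_apply, LinearMap.id_apply]
  rw [Algebra.smul_def]
  simp only [const, map_sub, map_inv₀]
  ring

theorem That_mul_ThatInv (p : Params K) {i : ℕ} (hi : i ≤ N) :
    That p N i * ThatInv p N i = 1 := by
  ext f
  simp only [Module.End.mul_apply, That_apply, ThatInv_apply, Module.End.one_apply, map_sub,
    map_neg, map_mul, map_inv₀, refl_const, refl_refl]
  have h := coeffT_add_refl p hi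
  have hc := const_ne_zero N (p.hecke N i)
  rw [← eq_sub_iff_add_eq'] at h
  rw [h]
  field_simp
  ring

theorem ThatInv_mul_That (p : Params K) {i : ℕ} (hi : i ≤ N) :
    ThatInv p N i * That p N i = 1 := by
  ext f
  simp only [Module.End.mul_apply, That_apply, ThatInv_apply, Module.End.one_apply, map_sub,
    map_neg, map_mul, refl_const, refl_refl]
  have h := coeffT_add_refl p hi
  have hc := const_ne_zero N (p.hecke N i)
  rw [← eq_sub_iff_add_eq'] at h
  rw [h]
  field_simp
  ring

/-- The operator `Ŷ_i = T̂_i ⋯ T̂_{N-1} T̂_N ⋯ T̂_1 T̂_0 T̂_1⁻¹ ⋯ T̂_{i-1}⁻¹`, `1 ≤ i ≤ N`. -/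
noncomputable def Yhat (p : Params K) (N : ℕ) [NeZero N] (i : ℕ) : Module.End K (RatFn K N) :=
  ((List.range' i (N - i)).map (That p N)).prod
    * ((List.range (N + 1)).reverse.map (That p N)).prod
    * ((List.range' 1 (i - 1)).map (ThatInv p N)).prod

end Hecke

/-! ### The space `V^{⊗N}`, the one-boundary Temperley–Lieb generators, `R`- and `K`-matrices -/

/-- Binary strings of length `N`; `true` stands for `+` and `false` for `-`. They index the
standard basis `v_ε` of `V^{⊗N}`, and a vector is given by its coordinates in this basis. -/
abbrev Str (N : ℕ) : Type := Fin N → Bool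

section Matrices

variable {K : Type*} [Field K] {N : ℕ} [NeZero N]

/-- The index of `+`, `-` in the ordered basis `(v_+, v_-)`. -/
def pos (a : Bool) : Fin 2 := if a then 0 else 1

/-- The index of `++`, `+-`, `-+`, `--` in the ordered basis of `V ⊗ V`. -/
def pos2 (a b : Bool) : Fin 4 :=
  if a then (if b then 0 else 1) else (if b then 2 else 3)

/-- The matrix of `e_i`, `1 ≤ i ≤ N`, in the standard basis; entry `(ε', ε)` is the coefficient
of `v_{ε'}` in `e_i v_ε`. -/
noncomputable def eMat (p : Params K) (N : ℕ) [NeZero N] (i : ℕ) : Matrix (Str N) (Str N) K :=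
  if i < N then
    Matrix.of fun ε' ε =>
      if ∀ k, k ≠ site N i → k ≠ site N (i + 1) → ε' k = ε k then
        !![0, 0, 0, 0;
           0, -(p.q : K)⁻¹, 1, 0;
           0, 1, -(p.q : K), 0;
           0, 0, 0, 0]
          (pos2 (ε' (site N i)) (ε' (site N (i + 1)))) (pos2 (ε (site N i)) (ε (site N (i + 1))))
      else 0
  else
    Matrix.of fun ε' ε =>
      if ∀ k, k ≠ site N N → ε' k = ε k then
        !![-(p.qN : K)⁻¹, (p.κN : K);
           (p.κN : K)⁻¹, -(p.qN : K)]
          (pos (ε' (site N N))) (pos (ε (site N N)))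
      else 0

/-- `e_i` with entries regarded as constant rational functions. -/
noncomputable def eRat (p : Params K) (N : ℕ) [NeZero N] (i : ℕ) :
    Matrix (Str N) (Str N) (RatFn K N) :=
  (eMat p N i).map (algebraMap K (RatFn K N))

/-- The matrix `Ř_i(x) = (qx - q⁻¹)/(q - q⁻¹x) + (x - 1)/(q - q⁻¹x) e_i`, `1 ≤ i ≤ N-1`. -/
noncomputable def Rmat (p : Params K) (i : ℕ) (x : RatFn K N) :
    Matrix (Str N) (Str N) (RatFn K N) :=
  let c := const (K := K) N
  ((c p.q * x - (c p.q)⁻¹) / (c p.q - (c p.q)⁻¹ * x)) • (1 : Matrix (Str N) (Str N) (RatFn K N))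
    + ((x - 1) / (c p.q - (c p.q)⁻¹ * x)) • eRat p N i

/-- The boundary matrix `K_N(x)`. -/
noncomputable def KNmat (p : Params K) (x : RatFn K N) : Matrix (Str N) (Str N) (RatFn K N) :=
  let c := const (K := K) N
  let D := (1 + c p.qN * c p.ζN * x) * (1 - c p.qN * (c p.ζN)⁻¹ * x)
  (((x + c p.qN * c p.ζN) * (x - c p.qN * (c p.ζN)⁻¹)) / D)
      • (1 : Matrix (Str N) (Str N) (RatFn K N))
    + (c p.qN * (x ^ 2 - 1) / D) • eRat p N N

end Matrices

/-! ### Kazhdan–Lusztig basis of type BII -/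

section KL

variable {K : Type*} [Field K] {N : ℕ}

/-- The sign of a letter, as an integer. -/
def sgn (a : Bool) : ℤ := if a then 1 else -1

/-- The letters at `i < j` are joined by an arc of the diagram of `ε`. Arcs join a down arrow `-`
with an up arrow `+` to its right and arise by repeatedly pairing adjacent unpaired `-`, `+`;
so `i` and `j` are joined exactly if they match like an opening and a closing bracket. -/
def IsArc (ε : Str N) (i j : Fin N) : Prop :=
  i < j ∧ ε i = false ∧ ε j = true ∧ ∑ k ∈ Finset.Icc i j, sgn (ε k) = 0 ∧
    ∀ m, i ≤ m → m < j → ∑ k ∈ Finset.Icc i m, sgn (ε k) < 0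

instance (ε : Str N) (i j : Fin N) : Decidable (IsArc ε i j) := by
  unfold IsArc; infer_instance

/-- The letter at `i` is not on an arc. -/
def IsUnpaired (ε : Str N) (i : Fin N) : Prop := ∀ j, ¬ IsArc ε i j ∧ ¬ IsArc ε j i

instance (ε : Str N) (i : Fin N) : Decidable (IsUnpaired ε i) := by
  unfold IsUnpaired; infer_instance

/-- The number of the unpaired down arrow at `i`, counted from the right, starting with 1. -/
def downIndex (ε : Str N) (i : Fin N) : ℕ :=
  (Finset.univ.filter fun k => i ≤ k ∧ ε k = false ∧ IsUnpaired ε k).card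

/-- An arc stands for `v_{-+} - q⁻¹ v_{+-}`; this is the coefficient of `v_{ab}`. -/
noncomputable def arcWeight (p : Params K) : Bool → Bool → K
  | false, true => 1
  | true, false => -(p.q : K)⁻¹
  | _, _ => 0

/-- An unpaired down arrow with number `n` from the right stands for `v_- - κ_N q_N⁻¹ v_+` for
odd `n` (mark `o`), and for `v_- + κ_N q⁻¹ q_N v_+` for even `n` (mark `e`); this is the
coefficient of `v_a`. -/
noncomputable def downWeight (p : Params K) (n : ℕ) : Bool → K
  | false => 1
  | true => if Odd n then -((p.κN : K) * (p.qN : K)⁻¹) else (p.κN : K) * (p.q : K)⁻¹ * (p.qN : K)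

/-- The Kazhdan–Lusztig basis vector `C_ε` of type BII: the tensor product of the building blocks
of the diagram of `ε`, an unpaired up arrow standing for `v_+`. -/
noncomputable def klBasis (p : Params K) (ε : Str N) : Str N → K := fun ε' =>
  (∏ i, ∏ j, if IsArc ε i j then arcWeight p (ε' i) (ε' j) else 1)
    * ∏ i, if IsUnpaired ε i then
        (if ε i = false then downWeight p (downIndex ε i) (ε' i)
          else if ε' i = true then 1 else 0)
      else 1

/-- The condition that every partial sum of the string is `≤ 0`. -/
def IsBallot (b : Str N) : Prop := ∀ j, ∑ k ∈ Finset.Iic j, sgn (b k) ≤ 0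

instance (b : Str N) : Decidable (IsBallot b) := by
  unfold IsBallot; infer_instance

/-- The set `𝓑_N` of strings all whose partial sums are `≤ 0`. -/
abbrev Ballot (N : ℕ) : Type := {b : Str N // IsBallot b}

/-- The function `Ψ(𝐳) = ∑_{b ∈ 𝓑_N} Ψ_b(𝐳) C_b`. -/
noncomputable def total (p : Params K) (Ψ : Ballot N → RatFn K N) : Str N → RatFn K N :=
  fun ε => ∑ b : Ballot N, Ψ b * algebraMap K (RatFn K N) (klBasis p b.1 ε)

/-- The one-boundary qKZ equation (in factorized form):
`Ψ(s₀𝐳) = Ψ(𝐳)`, `Ψ(s_i𝐳) = Ř_i(z_{i+1}/z_i) Ψ(𝐳)` for `1 ≤ i ≤ N-1`, and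
`Ψ(s_N𝐳) = K_N(z_N) Ψ(𝐳)`. -/
structure IsSolution [NeZero N] (p : Params K) (Ψ : Ballot N → RatFn K N) : Prop where
  left : (fun ε => refl p 0 (total p Ψ ε)) = total p Ψ
  bulk : ∀ i, 1 ≤ i → i < N →
    (fun ε => refl p i (total p Ψ ε))
      = (Rmat p i (z K N (i + 1) / z K N i)).mulVec (total p Ψ)
  right : (fun ε => refl p N (total p Ψ ε)) = (KNmat p (z K N N)).mulVec (total p Ψ)

end KL

/-! ### The strings `b₀` and `b_{(N+1)/2}` -/

theorem isBallot_of_nat {N : ℕ} (b : Str N) (f : ℕ → Bool) (hf : ∀ k : Fin N, b k = f k)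
    (h : ∀ m ≤ N, ∑ k ∈ Finset.range m, sgn (f k) ≤ 0) : IsBallot b := by
  intro j
  have hsum : ∑ k ∈ Finset.Iic j, sgn (b k) = ∑ k ∈ Finset.range (j + 1), sgn (f k) := by
    refine Finset.sum_bij (fun k _ => (k : ℕ)) ?_ ?_ ?_ ?_
    · intro a ha
      have : a ≤ j := by simpa using ha
      simp only [Finset.mem_range]
      exact Nat.lt_succ_of_le this
    · intro a _ b _ hab
      exact Fin.ext hab
    · intro n hn
      have hn' : n < j + 1 := by simpa using hn
      exact ⟨⟨n, by omega⟩, by simp only [Finset.mem_Iic, Fin.le_def]; omega, rfl⟩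
    · intro a _
      rw [hf]
  rw [hsum]
  exact h _ (by omega)

theorem sum_step (h m : ℕ) :
    ∑ k ∈ Finset.range m, sgn (decide (h ≤ k))
      = if m ≤ h then -(m : ℤ) else (m : ℤ) - 2 * h := by
  induction m with
  | zero => simp
  | succ m ih =>
    rw [Finset.sum_range_succ, ih]
    by_cases hm : h ≤ m
    · simp only [sgn, hm, decide_true, if_true]
      split_ifs <;> push_cast <;> omega
    · simp only [sgn, hm, decide_false]
      split_ifs <;> push_cast <;> first | omega | simp_all

theorem sum_step_last (h l m : ℕ) :
    ∑ k ∈ Finset.range m, sgn (decide (h ≤ k ∧ k < l))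
      ≤ ∑ k ∈ Finset.range (min m l), sgn (decide (h ≤ k)) := by
  induction m with
  | zero => simp
  | succ m ih =>
    rw [Finset.sum_range_succ]
    by_cases hm : m < l
    · rw [show min (m + 1) l = min m l + 1 by omega, Finset.sum_range_succ,
        show min m l = m by omega]
      rw [show min m l = m by omega] at ih
      simp only [hm, and_true]
      omega
    · rw [show min (m + 1) l = min m l by omega]
      simp only [sgn, hm, and_false, decide_false]
      simp only [sgn] at ih
      simp
      simp at ih
      omega

/-- The string `b₀`: first `⌊(N+1)/2⌋` letters `-`, then `⌊N/2⌋` letters `+`. -/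
def b0 (N : ℕ) : Ballot N :=
  ⟨fun k => decide ((N + 1) / 2 ≤ (k : ℕ)), by
    refine isBallot_of_nat _ (fun k => decide ((N + 1) / 2 ≤ k)) (fun _ => rfl) ?_
    intro m hm
    rw [sum_step]
    split_ifs <;> omega⟩

/-- The string `b_{(N+1)/2}` for odd `N`: first `(N-1)/2` letters `-`, then `(N-1)/2` letters `+`,
then one letter `-`. -/
def bLast (N : ℕ) (hN : Odd N) : Ballot N :=
  ⟨fun k => decide ((N - 1) / 2 ≤ (k : ℕ) ∧ (k : ℕ) < N - 1), by
    obtain ⟨n, rfl⟩ := hN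
    refine isBallot_of_nat _ (fun k => decide ((2 * n + 1 - 1) / 2 ≤ k ∧ k < 2 * n + 1 - 1))
      (fun _ => rfl) ?_
    intro m hm
    refine (sum_step_last _ _ _).trans ?_
    rw [sum_step]
    split_ifs <;> omega⟩

end OneBoundaryQKZ

/-! Write $g_i=e_i+q_i^{-1}$. Inserting the qKZ equation into the definition of $\hat T_i$ cancels
every rational coefficient: on the coordinates of $\Psi$, $\hat T_i$ acts as the constant matrix
$g_i$ for $1\le i\le N$, and $\hat T_0$ as $-q_0$. Dually, $\hat T_i\langle w,\Psi\rangle=\langle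
wg_i,\Psi\rangle$ for a constant functional $w$ (`That_pair`). The conjugates of $\hat T_0$ inside
$\hat Y_N$ still act as $-q_0$, so $\hat Y_i\langle w,\Psi\rangle=-q_0\langle wJ_i,\Psi\rangle$ with
$J_i=g_i\cdots g_N\cdots g_i$ (`Yhat_pair`). It remains to find functionals dual to two
Kazhdan–Lusztig vectors on which $J_i$ is computable.

Take $w=(v_-^*)^{\otimes n}\otimes\bigotimes_{j>n}(v_+^*+\kappa_Nq^{-(N-j)}\tau v_-^*)$ with
$(\tau-q_N^{-1})(\tau+q_N)=0$. Then $wg_N=\tau w$, and $wg_j=q^{-1}w$ for $n<j<N$, so $J_i$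
multiplies $w$ by $q^{-2(N-i)}\tau$ for $i>n$. The functional $wJ_n$ keeps the same tail
(`jucysMurphy_update`). A tail of this kind kills $C_b$ as soon as $b$ has a $-+$ inside the tail; a
last letter $-$ contributes $\kappa_N(\tau-q_N^{-1})$, and two last letters $-$ give $0$. Together
with the ballot condition, a single $b$ survives: $b_0$ for $\tau=q_N^{-1}$ and
$n=\lfloor(N+1)/2\rfloor$, or the string ending in $-$ for $N$ odd and $n=(N-1)/2$. Hence $wJ_n$ is
determined on the span of the $C_b$ by its value at that $b$, where it is the other root
$\tau'=q_N^{-1}-q_N-\tau$ times that of $w$ (`dot_jucysMurphy`). Below $n$ the head gives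
$wg_i=q^{-1}w$, and $\hat Y_i=\hat T_i\hat Y_{i+1}\hat T_i$ contributes $q^{-2}$ per step.

For the string ending in $-$ the natural choice $\tau=-q_N$ gives the value
$-\kappa_N(q_N+q_N^{-1})$, which vanishes when $q_N^2=-1$. To cover all parameters, $\tau$ is taken
as the generic root in $K[\tau]/((\tau-q_N^{-1})(\tau+q_N))$, and the coefficient of $\tau$ is
extracted at the end (`Yhat_bLast`). -/

namespace OneBoundaryQKZ

/-! ### The action of the Hecke algebra on functionals -/

section Functionals

variable {K : Type*} [Field K] {N : ℕ} [NeZero N]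

theorem site_val {k : ℕ} (h1 : 1 ≤ k) (hk : k ≤ N) : (site N k : ℕ) = k - 1 := by
  simp only [site, Fin.ofNat]
  exact Nat.mod_eq_of_lt (by omega)

theorem site_ne {k l : ℕ} (h1 : 1 ≤ k) (hk : k ≤ N) (h2 : 1 ≤ l) (hl : l ≤ N) (h : k ≠ l) :
    site N k ≠ site N l := by
  intro e
  have := congrArg Fin.val e
  rw [site_val h1 hk, site_val h2 hl] at this
  omega

variable {M : Type*} [AddCommGroup M] [Module K M]

/-- The right action of `e_{ab} + q⁻¹` on functionals on `V^{⊗N}`, where `e_{ab}` is the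
Temperley–Lieb generator acting on the tensor factors `a` and `b`. -/
noncomputable def braidAct {N : ℕ} (p : Params K) (a b : Fin N) (w : Str N → M) : Str N → M := fun ε =>
  if ε a = ε b then (p.q : K)⁻¹ • w ε
  else w (ε ∘ Equiv.swap a b) + if ε a then 0 else ((p.q : K)⁻¹ - p.q) • w ε

/-- The right action of `e_N + q_N⁻¹`, with `e_N` placed at the tensor factor `c`, on functionals
on `V^{⊗N}`. -/
noncomputable def boundaryAct (p : Params K) (c : Fin N) (w : Str N → M) : Str N → M := fun ε =>
  if ε c then (p.κN : K)⁻¹ • w (Function.update ε c false)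
  else (p.κN : K) • w (Function.update ε c true) + ((p.qN : K)⁻¹ - p.qN) • w ε

/-- The right action of `e_i + q_i⁻¹`, `1 ≤ i ≤ N`, on functionals on `V^{⊗N}`. -/
noncomputable def act (p : Params K) (i : ℕ) (w : Str N → M) : Str N → M :=
  if i < N then braidAct p (site N i) (site N (i + 1)) w else boundaryAct p (site N N) w

/-- The right action of `g_i ⋯ g_{N-1} g_N g_{N-1} ⋯ g_i`, where `i = N - m` and
`g_i = e_i + q_i⁻¹`, on functionals. -/
noncomputable def jucysMurphy (p : Params K) : ℕ → (Str N → M) → Str N → M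
  | 0, w => act p N w
  | m + 1, w => act p (N - (m + 1)) (jucysMurphy p m (act p (N - (m + 1)) w))

variable {M' : Type*} [AddCommGroup M'] [Module K M']

/-- The action has coefficients in $K$. This allows eigenvalue computations with functionals valued
in an extension algebra, followed by a linear map back to $K$. -/
theorem act_comp (p : Params K) (i : ℕ) (ℓ : M →ₗ[K] M') (w : Str N → M) :
    act p i (fun ε => ℓ (w ε)) = fun ε => ℓ (act p i w ε) := by
  unfold act
  split_ifs
  · funext ε
    simp only [braidAct]
    split_ifs <;> simp
  · funext ε
    simp only [boundaryAct]
    split_ifs <;> simp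

theorem jucysMurphy_comp (p : Params K) (m : ℕ) (ℓ : M →ₗ[K] M') (w : Str N → M) :
    jucysMurphy p m (fun ε => ℓ (w ε)) = fun ε => ℓ (jucysMurphy p m w ε) := by
  induction m generalizing w with
  | zero => exact act_comp p N ℓ w
  | succ m ih => simp only [jucysMurphy, act_comp, ih]

end Functionals

/-! ### The action of `T̂_i` and `Ŷ_i` on the components of a solution -/

theorem comp_swap_eq_iff {N : ℕ} {a b : Fin N} (hab : a ≠ b) {ε ε' : Str N} (h : ε a ≠ ε b) :
    (∀ k, k ≠ a → k ≠ b → ε k = ε' k) ∧ ε' a ≠ ε' b ↔ ε' = ε ∨ ε' = ε ∘ Equiv.swap a b := by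
  constructor
  · rintro ⟨h1, h2⟩
    by_cases h3 : ε' a = ε a
    · left
      funext k
      by_cases ka : k = a
      · rw [ka, h3]
      by_cases kb : k = b
      · subst kb
        revert h h2 h3
        cases ε a <;> cases ε k <;> cases ε' a <;> cases ε' k <;> simp
      · exact (h1 k ka kb).symm
    · right
      funext k
      by_cases ka : k = a
      · subst ka
        simp only [Function.comp_apply, Equiv.swap_apply_left]
        revert h h2 h3
        cases ε k <;> cases ε b <;> cases ε' k <;> cases ε' b <;> simp
      by_cases kb : k = b
      · subst kb
        simp only [Function.comp_apply, Equiv.swap_apply_right]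
        revert h h2 h3
        cases ε a <;> cases ε k <;> cases ε' a <;> cases ε' k <;> simp
      · simp [Equiv.swap_apply_of_ne_of_ne ka kb, h1 k ka kb]
  · rintro (rfl | rfl)
    · exact ⟨fun _ _ _ => rfl, h⟩
    · refine ⟨fun k ka kb => by simp [Equiv.swap_apply_of_ne_of_ne ka kb], ?_⟩
      simpa using h.symm

section Solution

variable {K : Type*} [Field K] {N : ℕ} [NeZero N]

theorem z_ne_const (k : ℕ) (a : Kˣ) : z K N k ≠ const N a := fun h =>
  z_sq_ne_const k (a ^ 2) (by rw [h]; simp [const])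

/-- Keeps the denominators of the $R$-matrices away from zero, as `z_ne_const` does for those of
$K_N$, without any genericity of the parameters. -/
theorem const_mul_z_ne {k l : ℕ} (hkl : site N k ≠ site N l) (a : Kˣ) :
    const N a * z K N k ≠ z K N l := by
  intro h
  have hc : const N a = algebraMap (Laurent K N) (RatFn K N) (algebraMap K _ (a : K)) :=
    IsScalarTower.algebraMap_apply K (Laurent K N) (RatFn K N) (a : K)
  rw [hc, z, z, ← map_mul, ← Algebra.smul_def] at h
  have h1 := IsFractionRing.injective (Laurent K N) (RatFn K N) h
  have h2 := congrArg (fun f : Laurent K N => f.coeff (Pi.single (site N k) 1)) h1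
  have h3 : (Pi.single (site N l) 1 : Fin N → ℤ) ≠ Pi.single (site N k) 1 := fun h => by
    simpa [hkl] using congrFun h (site N k)
  simp only [zUnit, AddMonoidAlgebra.coeff_smul, Finsupp.smul_apply,
    AddMonoidAlgebra.coeff_single, Finsupp.single_apply, if_neg h3, if_true, smul_eq_mul,
    mul_one] at h2
  exact a.ne_zero h2

/-- The matrix of $e_i$ is symmetric, so the formula for functionals also describes the action on
vectors. At the boundary, `eRat_mulVec_boundary` differs from `boundaryAct` by
$\kappa_N\leftrightarrow\kappa_N^{-1}$. -/
theorem eRat_mulVec_bulk (p : Params K) {i : ℕ} (h1 : 1 ≤ i) (hN : i < N)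
    (V : Str N → RatFn K N) (ε : Str N) :
    (eRat p N i).mulVec V ε + (p.q : K)⁻¹ • V ε
      = braidAct p (site N i) (site N (i + 1)) V ε := by
  have hab : site N i ≠ site N (i + 1) := site_ne h1 hN.le (by omega) hN (by omega)
  simp only [Matrix.mulVec, dotProduct, eRat, eMat, hN, if_true, Matrix.map_apply, Matrix.of_apply]
  generalize site N i = a at *
  generalize site N (i + 1) = b at *
  by_cases he : ε a = ε b
  · rw [Finset.sum_eq_zero, zero_add, braidAct, if_pos he]
    intro ε' _
    split_ifs with h
    · cases h3 : ε b <;> cases h4 : ε' a <;> cases h5 : ε' b <;> simp [pos2, he, h3]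
    · simp
  · have hne : ε ≠ ε ∘ Equiv.swap a b := fun h => he (by simpa using congrFun h a)
    rw [Fintype.sum_eq_add ε (ε ∘ Equiv.swap a b) hne]
    · rw [if_pos (fun _ _ _ => rfl), if_pos (fun k ka kb => by
        simp [Equiv.swap_apply_of_ne_of_ne ka kb])]
      rw [braidAct, if_neg he]
      simp only [Function.comp_apply, Equiv.swap_apply_left, Equiv.swap_apply_right]
      cases h3 : ε a <;> cases h4 : ε b <;>
        simp_all [pos2, Algebra.smul_def] <;> ring
    · rintro ε' ⟨h2, h3⟩
      split_ifs with h
      · have := mt (comp_swap_eq_iff hab he).1 (by tauto)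
        have h4 : ε' a = ε' b := by tauto
        cases h5 : ε' b <;> cases h6 : ε a <;> cases h7 : ε b <;> simp [pos2, h4, h5]
      · simp

/-- With $x=z_{i+1}/z_i$ one has $\check R_i(x)-1=\frac{x-1}{q-q^{-1}x}(e_i+q+q^{-1})$, and the
coefficient in $\hat T_i$ is minus the inverse of this fraction. -/
theorem That_eq_of_bulk {p : Params K} {Ψ : Ballot N → RatFn K N} (hΨ : IsSolution p Ψ)
    {i : ℕ} (h1 : 1 ≤ i) (hN : i < N) (ε : Str N) :
    That p N i (total p Ψ ε) = braidAct p (site N i) (site N (i + 1)) (total p Ψ) ε := by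
  have h := congrFun (hΨ.bulk i h1 hN) ε
  simp only [Rmat, Matrix.add_mulVec, Matrix.smul_mulVec, Matrix.one_mulVec, Pi.add_apply,
    Pi.smul_apply, smul_eq_mul] at h
  rw [← eRat_mulVec_bulk p h1 hN, That_apply, h]
  generalize (eRat p N i).mulVec (total p Ψ) ε = e
  generalize total p Ψ ε = v
  have hq := const_ne_zero (K := K) N p.q
  have hi := z_ne_zero (K := K) (N := N) i
  have hj := z_ne_zero (K := K) (N := N) (i + 1)
  have hne : z K N i - z K N (i + 1) ≠ 0 := by
    rw [sub_ne_zero]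
    intro h
    have := z_injective (by simp; omega) (by simp; omega) h
    omega
  have hne' : z K N (i + 1) - z K N i ≠ 0 := by
    rwa [← neg_ne_zero, neg_sub]
  have hD : const N p.q ^ 2 * z K N i - z K N (i + 1) ≠ 0 := by
    have := const_mul_z_ne (K := K) (site_ne h1 hN.le (by omega) hN (by omega) :
      site N i ≠ site N (i + 1)) (p.q ^ 2)
    rw [sub_ne_zero]
    simpa [const] using this
  have e1 : (p.q : K)⁻¹ • v = (const N p.q)⁻¹ * v := by
    simp [const, Algebra.smul_def]
  have e2 : const N p.q - (const N p.q)⁻¹ * (z K N (i + 1) / z K N i)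
      = (const N p.q ^ 2 * z K N i - z K N (i + 1)) / (const N p.q * z K N i) := by
    field_simp
  have e3 : 1 - z K N i / z K N (i + 1) = (z K N (i + 1) - z K N i) / z K N (i + 1) := by
    field_simp
  rw [e1, e2]
  simp only [coeffT, Params.hecke, if_neg (by omega : ¬ i = 0), hN, if_true, e3]
  field_simp
  ring

theorem eRat_mulVec_boundary (p : Params K) (V : Str N → RatFn K N) (ε : Str N) :
    (eRat p N N).mulVec V ε + (p.qN : K)⁻¹ • V ε
      = if ε (site N N) then (p.κN : K) • V (Function.update ε (site N N) false)
        else (p.κN : K)⁻¹ • V (Function.update ε (site N N) true)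
          + ((p.qN : K)⁻¹ - p.qN) • V ε := by
  simp only [Matrix.mulVec, dotProduct, eRat, eMat, lt_irrefl, if_false, Matrix.map_apply,
    Matrix.of_apply]
  generalize site N N = c
  have hne : ε ≠ Function.update ε c (!ε c) := fun h => by simpa using congrFun h c
  rw [Fintype.sum_eq_add ε (Function.update ε c (!ε c)) hne]
  · rw [if_pos (fun _ _ => rfl), if_pos (fun k hk => by simp [hk])]
    cases h : ε c <;> simp [pos, h, Algebra.smul_def] <;> ring
  · rintro ε' ⟨h2, h3⟩
    rw [if_neg, map_zero, zero_mul]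
    intro h
    by_cases h4 : ε' c = ε c
    · apply h2
      funext k
      by_cases hk : k = c
      · rw [hk, h4]
      · exact (h k hk).symm
    · apply h3
      funext k
      by_cases hk : k = c
      · subst hk
        simp only [Function.update_self]
        revert h4
        cases ε' k <;> cases ε k <;> simp
      · simp [hk, h k hk]

theorem That_eq_of_right {p : Params K} {Ψ : Ballot N → RatFn K N} (hΨ : IsSolution p Ψ)
    (ε : Str N) :
    That p N N (total p Ψ ε)
      = (eRat p N N).mulVec (total p Ψ) ε + (p.qN : K)⁻¹ • total p Ψ ε := by
  have h := congrFun hΨ.right ε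
  simp only [KNmat, Matrix.add_mulVec, Matrix.smul_mulVec, Matrix.one_mulVec, Pi.add_apply,
    Pi.smul_apply, smul_eq_mul] at h
  rw [That_apply, h]
  generalize (eRat p N N).mulVec (total p Ψ) ε = e
  generalize total p Ψ ε = v
  have hq := const_ne_zero (K := K) N p.qN
  have hζ := const_ne_zero (K := K) N p.ζN
  have h1 : 1 - z K N N ^ 2 ≠ 0 := by
    rw [sub_ne_zero]
    simpa [const] using (z_sq_ne_const (K := K) (N := N) N 1).symm
  have h2 : 1 + const N p.qN * const N p.ζN * z K N N ≠ 0 := by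
    intro h
    apply z_ne_const (K := K) (N := N) N (-(p.qN * p.ζN)⁻¹)
    simp only [const, Units.val_neg, Units.val_inv_eq_inv_val, Units.val_mul, map_neg,
      map_inv₀, map_mul] at h hq hζ ⊢
    field_simp
    linear_combination h
  have h3 : 1 - const N p.qN * (const N p.ζN)⁻¹ * z K N N ≠ 0 := by
    intro h
    apply z_ne_const (K := K) (N := N) N (p.qN⁻¹ * p.ζN)
    simp only [const, Units.val_inv_eq_inv_val, Units.val_mul, map_mul,
      map_inv₀ (algebraMap K (RatFn K N))] at h hq hζ ⊢
    field_simp at h ⊢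
    linear_combination -h
  have e1 : (p.qN : K)⁻¹ • v = (const N p.qN)⁻¹ * v := by
    simp [const, Algebra.smul_def]
  rw [e1]
  simp only [coeffT, Params.hecke, NeZero.ne N, lt_irrefl, if_false]
  set D := (1 + const N p.qN * const N p.ζN * z K N N)
    * (1 - const N p.qN * (const N p.ζN)⁻¹ * z K N N) with hD
  have hD0 : D ≠ 0 := mul_ne_zero h2 h3
  -- This is the numerator of $K_N$; it gives $K_N(x)-1=\frac{q_N(x^2-1)}{D}(e_N+q_N+q_N^{-1})$,
  -- whose prefactor cancels against `coeffT`.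
  have e2 : (z K N N + const N p.qN * const N p.ζN) * (z K N N - const N p.qN * (const N p.ζN)⁻¹)
      = D - (1 - z K N N ^ 2) * (1 + const N p.qN ^ 2) := by
    rw [hD]
    field_simp
    ring
  rw [e2]
  clear_value D
  field_simp
  ring

theorem That_zero_total {p : Params K} {Ψ : Ballot N → RatFn K N} (hΨ : IsSolution p Ψ)
    (ε : Str N) : That p N 0 (total p Ψ ε) = -(p.q0 : K) • total p Ψ ε := by
  have h : refl p 0 (total p Ψ ε) = total p Ψ ε := congrFun hΨ.left ε
  rw [That_apply, h]
  simp [Params.hecke, const, Algebra.smul_def]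

/-- The value of a functional on `V^{⊗N}` at `Ψ`. -/
noncomputable def pair (w : Str N → K) (V : Str N → RatFn K N) : RatFn K N := ∑ ε, w ε • V ε

/-- $\hat T_i$ is $K$-linear and $w$ is constant, so the matrix acting on $\Psi$ can be transposed
onto $w$, by reindexing along the swap of two letters or the flip of the last one. -/
theorem That_pair {p : Params K} {Ψ : Ballot N → RatFn K N} (hΨ : IsSolution p Ψ)
    {i : ℕ} (h1 : 1 ≤ i) (hN : i ≤ N) (w : Str N → K) :
    That p N i (pair w (total p Ψ)) = pair (act p i w) (total p Ψ) := by
  simp only [pair, map_sum, map_smul]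
  rcases hN.lt_or_eq with hlt | rfl
  · simp only [That_eq_of_bulk hΨ h1 hlt, act, hlt, if_true]
    generalize site N i = a
    generalize site N (i + 1) = b
    generalize total p Ψ = V
    let σ : Str N ≃ Str N := Equiv.arrowCongr (Equiv.swap a b) (Equiv.refl Bool)
    have hσ : ∀ ε : Str N, σ ε = ε ∘ Equiv.swap a b := fun ε => by
      funext k
      simp [σ, Equiv.arrowCongr]
    have key : ∑ ε, (if ε a = ε b then 0 else w ε • V (ε ∘ Equiv.swap a b))
        = ∑ ε, (if ε a = ε b then 0 else w (ε ∘ Equiv.swap a b) • V ε) := by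
      refine Fintype.sum_equiv σ _ _ fun ε => ?_
      rw [hσ]
      have : (ε ∘ Equiv.swap a b) ∘ Equiv.swap a b = ε := by
        funext k
        simp
      simp only [this, Function.comp_apply, Equiv.swap_apply_left, Equiv.swap_apply_right]
      simp [eq_comm]
    have e1 : ∀ ε, w ε • braidAct p a b V ε
        = (if ε a = ε b then 0 else w ε • V (ε ∘ Equiv.swap a b))
          + (if ε a = ε b then (p.q : K)⁻¹ • w ε
              else if ε a then 0 else ((p.q : K)⁻¹ - p.q) • w ε) • V ε := fun ε => by
      simp only [braidAct]
      split_ifs <;> simp [smul_smul, mul_comm]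
    have e2 : ∀ ε, braidAct p a b w ε • V ε
        = (if ε a = ε b then 0 else w (ε ∘ Equiv.swap a b) • V ε)
          + (if ε a = ε b then (p.q : K)⁻¹ • w ε
              else if ε a then 0 else ((p.q : K)⁻¹ - p.q) • w ε) • V ε := fun ε => by
      simp only [braidAct]
      split_ifs <;> simp [add_smul]
    simp only [e1, e2, Finset.sum_add_distrib, key]
  · simp only [That_eq_of_right hΨ, eRat_mulVec_boundary, act, lt_irrefl, if_false]
    generalize total p Ψ = V
    generalize site i i = c
    let σ : Str i ≃ Str i :=
      Function.Involutive.toPerm (fun ε => Function.update ε c (!ε c)) fun ε => by simp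
    have hσ : ∀ ε : Str i, σ ε = Function.update ε c (!ε c) := fun ε => rfl
    have key : ∑ ε, w ε • (if ε c then (p.κN : K) else (p.κN : K)⁻¹)
            • V (Function.update ε c (!ε c))
        = ∑ ε, ((if ε c then (p.κN : K)⁻¹ else (p.κN : K)) • w (Function.update ε c (!ε c)))
            • V ε := by
      refine Fintype.sum_equiv σ _ _ fun ε => ?_
      rw [hσ]
      cases h : ε c <;> simp [smul_smul, mul_comm, ← h]
    have e1 : ∀ ε, (w ε • if ε c = true then (p.κN : K) • V (Function.update ε c false)
          else (p.κN : K)⁻¹ • V (Function.update ε c true) + ((p.qN : K)⁻¹ - p.qN) • V ε)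
        = w ε • (if ε c then (p.κN : K) else (p.κN : K)⁻¹) • V (Function.update ε c (!ε c))
          + (if ε c then 0 else ((p.qN : K)⁻¹ - p.qN) • w ε) • V ε := fun ε => by
      cases h : ε c <;> simp [smul_smul, mul_comm]
    have e2 : ∀ ε, boundaryAct p c w ε • V ε
        = ((if ε c then (p.κN : K)⁻¹ else (p.κN : K)) • w (Function.update ε c (!ε c))) • V ε
          + (if ε c then 0 else ((p.qN : K)⁻¹ - p.qN) • w ε) • V ε := fun ε => by
      simp only [boundaryAct]
      cases h : ε c <;> simp [add_smul]
    simp only [e1, e2, Finset.sum_add_distrib, key]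

theorem Yhat_eq_That_mul (p : Params K) {i : ℕ} (h1 : 1 ≤ i) (hN : i < N) :
    Yhat p N i = That p N i * Yhat p N (i + 1) * That p N i := by
  have e1 : List.range' i (N - i) = i :: List.range' (i + 1) (N - (i + 1)) := by
    rw [show N - i = (N - (i + 1)) + 1 by omega, List.range'_succ]
  have e2 : List.range' 1 (i + 1 - 1) = List.range' 1 (i - 1) ++ [i] := by
    rw [show i + 1 - 1 = (i - 1) + 1 by omega, List.range'_concat]
    simp
    omega
  simp only [Yhat, e1, e2, List.map_cons, List.prod_cons, List.map_append, List.prod_append,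
    List.map_nil, List.prod_nil, mul_one, mul_assoc, ThatInv_mul_That p hN.le]

theorem Yhat_last_apply {p : Params K} {Ψ : Ballot N → RatFn K N} (hΨ : IsSolution p Ψ)
    (w : Str N → K) :
    Yhat p N N (pair w (total p Ψ)) = -(p.q0 : K) • pair (act p N w) (total p Ψ) := by
  -- Since $\hat T_k^{-1}$ differs from $\hat T_k$ by a scalar, it preserves the space of all
  -- $\langle w,\Psi\rangle$. There $\hat T_0$ is the scalar $-q_0$, and so are its conjugates.
  have key : ∀ k, k < N → ∀ w : Str N → K,
      (((List.range (k + 1)).reverse.map (That p N)).prod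
        * ((List.range' 1 k).map (ThatInv p N)).prod) (pair w (total p Ψ))
        = -(p.q0 : K) • pair w (total p Ψ) := by
    intro k
    induction k with
    | zero =>
      intro _ w
      simp only [pair, zero_add, List.range_one, List.reverse_singleton, List.map_cons,
        List.map_nil, List.prod_cons, List.prod_nil, mul_one, List.range'_zero, map_sum, map_smul,
        That_zero_total hΨ, Finset.smul_sum]
      exact Finset.sum_congr rfl fun ε _ => smul_comm _ _ _
    | succ k ih =>
      intro hk w
      have e : ThatInv p N (k + 1) (pair w (total p Ψ))
          = pair (act p (k + 1) w + ((p.hecke N (k + 1) : K) - (p.hecke N (k + 1) : K)⁻¹) • w)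
              (total p Ψ) := by
        simp only [ThatInv, LinearMap.add_apply, LinearMap.smul_apply, LinearMap.id_apply,
          That_pair hΨ (Nat.succ_pos k) hk.le]
        simp [pair, add_smul, Finset.sum_add_distrib, Finset.smul_sum, smul_smul]
      rw [List.range_succ, List.range'_concat]
      simp only [List.reverse_append, List.reverse_singleton, List.singleton_append, List.map_cons,
        List.prod_cons, List.map_append, List.prod_append, List.map_nil, List.prod_nil, mul_one,
        Module.End.mul_apply, one_mul, add_comm 1 k]
      rw [e]
      simp only [Module.End.mul_apply] at ih
      rw [ih (by omega), ← e, map_smul, ← Module.End.mul_apply, That_mul_ThatInv p hk.le,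
        Module.End.one_apply]
  have h := key (N - 1) (Nat.pred_lt (NeZero.ne N)) w
  rw [Nat.sub_add_cancel (NeZero.one_le)] at h
  rw [Yhat, Nat.sub_self, List.range'_zero, List.map_nil, List.prod_nil, one_mul, List.range_succ]
  simp only [List.reverse_append, List.reverse_singleton, List.singleton_append, List.map_cons,
    List.prod_cons, mul_assoc]
  rw [Module.End.mul_apply, h, map_smul, That_pair hΨ NeZero.one_le le_rfl]

/-- Passing to functionals reverses products, which does not matter here because $J_i$ is a
palindrome. -/
theorem Yhat_pair {p : Params K} {Ψ : Ballot N → RatFn K N} (hΨ : IsSolution p Ψ)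
    (w : Str N → K) {m : ℕ} (hm : m < N) :
    Yhat p N (N - m) (pair w (total p Ψ))
      = -(p.q0 : K) • pair (jucysMurphy p m w) (total p Ψ) := by
  induction m generalizing w with
  | zero => exact Yhat_last_apply hΨ w
  | succ m ih =>
    rw [Yhat_eq_That_mul p (by omega) (by omega), show N - (m + 1) + 1 = N - m by omega,
      Module.End.mul_apply, Module.End.mul_apply, That_pair hΨ (by omega) (by omega),
      ih _ (by omega), map_smul, That_pair hΨ (by omega) (by omega)]
    rfl

end Solution

/-! ### Functionals with a product tail -/

section Tail

variable {K : Type*} [Field K] {N : ℕ} [NeZero N]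

theorem update_update_comp_swap {α β : Type*} [DecidableEq α] {a b : α} (hab : a ≠ b) (ε : α → β)
    (x y : β) :
    Function.update (Function.update ε a x) b y ∘ Equiv.swap a b
      = Function.update (Function.update ε a y) b x := by
  funext k
  by_cases ka : k = a
  · subst ka
    simp [hab]
  by_cases kb : k = b
  · subst kb
    simp [hab]
  · simp [Equiv.swap_apply_of_ne_of_ne ka kb, ka, kb]

theorem update_comp_swap_of_ne {α β : Type*} [DecidableEq α] {a b c : α} (ha : c ≠ a) (hb : c ≠ b)
    (ε : α → β) (x : β) :
    Function.update ε c x ∘ Equiv.swap a b = Function.update (ε ∘ Equiv.swap a b) c x := by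
  funext k
  by_cases ka : k = a
  · subst ka
    simp [ha.symm, hb.symm]
  by_cases kb : k = b
  · subst kb
    simp [ha.symm, hb.symm]
  by_cases kc : k = c
  · subst kc
    simp [Equiv.swap_apply_of_ne_of_ne ka kb]
  · simp [Equiv.swap_apply_of_ne_of_ne ka kb, kc]

section Module

variable {M : Type*} [AddCommGroup M] [Module K M]

theorem braidAct_update_update {N : ℕ} (p : Params K) {a b : Fin N} (hab : a ≠ b) (w : Str N → M)
    (ε : Str N) (x y : Bool) :
    braidAct p a b w (Function.update (Function.update ε a x) b y)
      = if x = y then (p.q : K)⁻¹ • w (Function.update (Function.update ε a x) b y)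
        else w (Function.update (Function.update ε a y) b x)
          + if x then 0
            else ((p.q : K)⁻¹ - p.q) • w (Function.update (Function.update ε a x) b y) := by
  simp [braidAct, update_update_comp_swap hab, Function.update_of_ne hab]

theorem boundaryAct_update {N : ℕ} (p : Params K) (c : Fin N) (w : Str N → M) (ε : Str N) (x : Bool) :
    boundaryAct p c w (Function.update ε c x)
      = if x then (p.κN : K)⁻¹ • w (Function.update ε c false)
        else (p.κN : K) • w (Function.update ε c true)
          + ((p.qN : K)⁻¹ - p.qN) • w (Function.update ε c false) := by
  cases x <;> simp [boundaryAct]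

end Module

variable {S : Type*} [CommRing S] [Algebra K S]

/-- The weight of `v_-` relative to `v_+` at the tensor factor `j` in the product functional that
is an eigenvector of `e_N + q_N⁻¹` with eigenvalue `τ` and of `e_i + q⁻¹` with eigenvalue
`q⁻¹`. -/
noncomputable def tailWeight (p : Params K) (N : ℕ) (τ : S) (j : ℕ) : S :=
  ((p.κN : K) * (p.q : K)⁻¹ ^ (N - j)) • τ

/-- The functional `w` is a product at the tensor factors `j > n`, with weights `1` for `v_+` and
`tailWeight p N τ j` for `v_-`. -/
def HasTail (p : Params K) (τ : S) (n : ℕ) (w : Str N → S) : Prop :=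
  ∀ j, n < j → j ≤ N → ∀ ε, w (Function.update ε (site N j) false)
    = tailWeight p N τ j * w (Function.update ε (site N j) true)

/-- Acting on the factors $i,i+1$ can spoil only the factor $i+1$ of the tail; the rest is enough
for induction. -/
theorem HasTail.braidAct {p : Params K} {τ : S} {i : ℕ} {w : Str N → S} (h : HasTail p τ i w)
    (h1 : 1 ≤ i) (hi : i < N) :
    HasTail p τ (i + 1) (braidAct p (site N i) (site N (i + 1)) w) := by
  intro j hj hjN ε
  have ha : site N j ≠ site N i := site_ne (by omega) hjN h1 hi.le (by omega)
  have hb : site N j ≠ site N (i + 1) := site_ne (by omega) hjN (by omega) hi (by omega)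
  simp only [OneBoundaryQKZ.braidAct, update_comp_swap_of_ne ha hb,
    Function.update_of_ne ha.symm, Function.update_of_ne hb.symm, h j (by omega) hjN]
  split_ifs <;> simp [mul_add]

/-- On functionals with a tail beyond $n=N-m$, $J_n$ acts only on the factor $n$. Its $2\times2$
matrix has trace $q^{-2m}\tau+\tau'$ and determinant $-q^{-2m}=q^{-2m}\tau\tau'$, where
$\tau'=q_N^{-1}-q_N-\tau$ is the other root. The induction peels off the outer $g_n$ on both sides.
-/
theorem jucysMurphy_update {p : Params K} {τ : S}
    (hτ : (τ - algebraMap K S (p.qN : K)⁻¹) * (τ + algebraMap K S p.qN) = 0)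
    {m : ℕ} (hm : m < N) {w : Str N → S} (hw : HasTail p τ (N - m) w) (ε : Str N) :
    jucysMurphy p m w (Function.update ε (site N (N - m)) true)
        = ((p.q : K)⁻¹ ^ m * (p.κN : K)⁻¹) • w (Function.update ε (site N (N - m)) false) ∧
      jucysMurphy p m w (Function.update ε (site N (N - m)) false)
        = ((p.q : K)⁻¹ ^ m * (p.κN : K)) • w (Function.update ε (site N (N - m)) true)
          + (((p.q : K)⁻¹ ^ (2 * m)) • τ - (τ - algebraMap K S ((p.qN : K)⁻¹ - p.qN)))
            * w (Function.update ε (site N (N - m)) false) := by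
  induction m generalizing w ε with
  | zero =>
    simp only [jucysMurphy, act, lt_irrefl, if_false, Nat.sub_zero, boundaryAct_update]
    simp [Algebra.smul_def]
  | succ m ih =>
    have hi : N - (m + 1) < N := by omega
    have hi1 : N - (m + 1) + 1 = N - m := by omega
    have hab : site N (N - (m + 1)) ≠ site N (N - m) :=
      site_ne (by omega) hi.le (by omega) (by omega) (by omega)
    have hw' := hw.braidAct (by omega) hi
    rw [hi1] at hw'
    have ih' := ih (by omega) hw'
    have hwt := hw (N - m) (by omega) (by omega)
    simp only [jucysMurphy, act, hi, if_true, hi1]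
    have hy : tailWeight p N τ (N - m) = ((p.κN : K) * (p.q : K)⁻¹ ^ m) • τ := by
      rw [tailWeight, show N - (N - m) = m by omega]
    rw [hy] at hwt
    generalize site N (N - (m + 1)) = a at *
    generalize site N (N - m) = b at *
    generalize jucysMurphy p m (braidAct p a b w) = v at *
    have e1 := fun x => (ih' (Function.update ε a x)).1
    have e2 := fun x => (ih' (Function.update ε a x)).2
    clear ih ih' hw hw'
    have hq : algebraMap K S p.q * algebraMap K S (p.q : K)⁻¹ = 1 := by
      rw [← map_mul, mul_inv_cancel₀ p.q.ne_zero, map_one]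
    have hκ : algebraMap K S p.κN * algebraMap K S (p.κN : K)⁻¹ = 1 := by
      rw [← map_mul, mul_inv_cancel₀ p.κN.ne_zero, map_one]
    have hN : algebraMap K S p.qN * algebraMap K S (p.qN : K)⁻¹ = 1 := by
      rw [← map_mul, mul_inv_cancel₀ p.qN.ne_zero, map_one]
    -- Both letters at $a$ and $b$ are made explicit, so that each claim becomes an identity in $S$
    -- for fixed letters.
    obtain ⟨y, hy⟩ : ∃ y, ε = Function.update ε b y := ⟨ε b, by simp⟩
    have hu : ∀ x, Function.update ε a x = Function.update (Function.update ε a x) b y := by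
      intro x
      conv_lhs => rw [hy]
      exact Function.update_comm hab.symm y x ε
    rw [hu true, hu false]
    clear hu hy
    have hB := braidAct_update_update p hab w ε
    have hBv := braidAct_update_update p hab v ε
    have e1t := e1 true
    have e1f := e1 false
    have e2t := e2 true
    have e2f := e2 false
    have h1 := hwt (Function.update ε a true)
    have h2 := hwt (Function.update ε a false)
    clear e1 e2 hwt
    rw [hB] at e1t e1f
    rw [hB, hB] at e2t e2f
    cases y <;> rw [hBv, hBv] <;>
    simp only [h1, h2, e1t, e1f, e2t, e2f, reduceCtorEq, if_true,
      if_false, Algebra.smul_def, map_mul, map_pow, map_sub, add_zero] <;> constructor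
    · ring
    -- The value at $--$ is the only one that needs the quadratic relation for $\tau$.
    · linear_combination algebraMap K S p.κN * algebraMap K S (p.q : K)⁻¹ ^ m
        * w (Function.update (Function.update ε a false) b true)
        * ((1 - algebraMap K S (p.q : K)⁻¹ ^ 2) * (hτ + hN) - hq)
    · ring
    · linear_combination algebraMap K S (p.q : K)⁻¹ ^ (2 * m) * τ
        * w (Function.update (Function.update ε a false) b true)
        * ((algebraMap K S (p.q : K)⁻¹ - algebraMap K S p.q) * algebraMap K S (p.q : K)⁻¹ * hκ - hq)

end Tail
/-! ### Partial sums and arcs -/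

section Arcs

variable {N : ℕ} [NeZero N]

/-- The sum of the first `k` letters. -/
def prefixSum (b : Str N) (k : ℕ) : ℤ := ∑ j ∈ Finset.range k, sgn (b (site N (j + 1)))

theorem site_succ_val (k : Fin N) : site N (k + 1) = k := by
  apply Fin.ext
  rw [site_val (by omega) (by omega)]
  omega

theorem prefixSum_succ (b : Str N) (k : Fin N) :
    prefixSum b (k + 1) = prefixSum b k + sgn (b k) := by
  rw [prefixSum, Finset.sum_range_succ, site_succ_val]
  rfl

theorem sum_Icc_sgn (b : Str N) {i j : Fin N} (h : i ≤ j) :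
    ∑ k ∈ Finset.Icc i j, sgn (b k) = prefixSum b (j + 1) - prefixSum b i := by
  have h1 : ∑ k ∈ Finset.Icc i j, sgn (b k)
      = ∑ k ∈ (Finset.Icc i j).map Fin.valEmbedding, sgn (b (site N (k + 1))) := by
    rw [Finset.sum_map]
    exact Finset.sum_congr rfl fun k _ => by rw [Fin.valEmbedding_apply, site_succ_val]
  rw [h1, Fin.map_valEmbedding_Icc, prefixSum, prefixSum, ← Finset.sum_Ico_eq_sub]
  · rfl
  · have : (i : ℕ) ≤ j := h
    omega

theorem isArc_iff (b : Str N) (i j : Fin N) :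
    IsArc b i j ↔ i < j ∧ b i = false ∧ b j = true ∧ prefixSum b (j + 1) = prefixSum b i ∧
      ∀ m : Fin N, i ≤ m → m < j → prefixSum b (m + 1) < prefixSum b i := by
  unfold IsArc
  constructor
  · rintro ⟨h1, h2, h3, h4, h5⟩
    rw [sum_Icc_sgn b h1.le] at h4
    refine ⟨h1, h2, h3, by omega, fun m hm hm' => ?_⟩
    have := h5 m hm hm'
    rw [sum_Icc_sgn b hm] at this
    omega
  · rintro ⟨h1, h2, h3, h4, h5⟩
    refine ⟨h1, h2, h3, by rw [sum_Icc_sgn b h1.le]; omega, fun m hm hm' => ?_⟩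
    rw [sum_Icc_sgn b hm]
    have := h5 m hm hm'
    omega

theorem IsBallot.prefixSum_le {b : Str N} (hb : IsBallot b) {k : ℕ} (hk : k ≤ N) :
    prefixSum b k ≤ 0 := by
  rcases Nat.eq_zero_or_pos k with rfl | h
  · simp [prefixSum]
  · have h1 := hb ⟨k - 1, by omega⟩
    have h2 : Finset.Iic (⟨k - 1, by omega⟩ : Fin N)
        = Finset.Icc ⟨0, by omega⟩ ⟨k - 1, by omega⟩ := by
      ext x
      simp [Fin.le_def]
    rw [h2, sum_Icc_sgn b (by simp)] at h1
    simpa [prefixSum, Nat.sub_add_cancel h] using h1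

theorem neg_le_prefixSum (b : Str N) (k : ℕ) : -(k : ℤ) ≤ prefixSum b k := by
  induction k with
  | zero => simp [prefixSum]
  | succ k ih =>
    rw [prefixSum, Finset.sum_range_succ, ← prefixSum, sgn]
    push_cast
    split_ifs <;> omega

/-- A single $+$ raises the minimal sum $-k$ by $2$, so a slack of $1$ is harmless. It is needed for
$b_0$ with $N$ odd. -/
theorem eq_false_of_prefixSum_le {b : Str N} {k : ℕ} (h : prefixSum b k ≤ -(k : ℤ) + 1) {j : ℕ}
    (h1 : 1 ≤ j) (hj : j ≤ k) : b (site N j) = false := by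
  induction k with
  | zero => omega
  | succ k ih =>
    rw [prefixSum, Finset.sum_range_succ, ← prefixSum, sgn] at h
    have h2 := neg_le_prefixSum b k
    push_cast at h
    rcases hj.lt_or_eq with hlt | rfl
    · refine ih ?_ (by omega)
      split_ifs at h <;> omega
    · by_contra hne
      rw [Bool.not_eq_false] at hne
      rw [if_pos hne] at h
      omega

theorem prefixSum_of_true {b : Str N} {n k : ℕ} (hn : n ≤ k)
    (h : ∀ j, n < j → j ≤ k → b (site N j) = true) :
    prefixSum b k = prefixSum b n + (k - n) := by
  induction k, hn using Nat.le_induction with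
  | base => simp
  | succ k hk ih =>
    rw [prefixSum, Finset.sum_range_succ, ← prefixSum, ih fun j h1 h2 => h j h1 (by omega),
      h (k + 1) (by omega) le_rfl]
    simp [sgn]
    ring

theorem prefixSum_of_false {b : Str N} {k : ℕ}
    (h : ∀ j, 1 ≤ j → j ≤ k → b (site N j) = false) : prefixSum b k = -k := by
  induction k with
  | zero => simp [prefixSum]
  | succ k ih =>
    rw [prefixSum, Finset.sum_range_succ, ← prefixSum, ih fun j h1 h2 => h j h1 (by omega),
      h (k + 1) (by omega) le_rfl]
    simp [sgn]
    ring

/-- The arcs of a string that starts with `n` letters `-` followed by letters `+` up to the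
position `k` are nested. -/
theorem isArc_of_nested {b : Str N} {n k : ℕ} (hk : k ≤ N)
    (h1 : ∀ j, 1 ≤ j → j ≤ n → b (site N j) = false)
    (h2 : ∀ j, n < j → j ≤ k → b (site N j) = true)
    {i j : ℕ} (hi : 1 ≤ i) (hin : i ≤ n) (hjn : n < j) (hjk : j ≤ k) (hij : i + j = 2 * n + 1) :
    IsArc b (site N i) (site N j) := by
  have e1 : ∀ l, l ≤ n → prefixSum b l = -l := fun l hl =>
    prefixSum_of_false fun j h h' => h1 j h (by omega)
  have e2 : ∀ l, n ≤ l → l ≤ k → prefixSum b l = l - 2 * n := fun l hl hl' => by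
    rw [prefixSum_of_true hl fun j h h' => h2 j h (by omega), e1 n le_rfl]
    ring
  have hvi := site_val (N := N) hi (by omega)
  have hvj := site_val (N := N) (k := j) (by omega) (by omega)
  rw [isArc_iff]
  refine ⟨by rw [Fin.lt_def]; omega, h1 i hi hin, h2 j hjn hjk, ?_, fun m hm hm' => ?_⟩
  · rw [hvi, hvj, e1 (i - 1) (by omega), e2 (j - 1 + 1) (by omega) (by omega)]
    omega
  · rw [Fin.le_def] at hm
    rw [Fin.lt_def] at hm'
    rw [hvi, e1 (i - 1) (by omega)]
    rcases le_total (m + 1 : ℕ) n with h | h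
    · rw [e1 _ h]
      omega
    · rw [e2 _ h (by omega)]
      omega

/-- Letters `-+` at adjacent positions are joined, and are on no other arc. -/
theorem isArc_adjacent {b : Str N} {a c : Fin N} (hac : (c : ℕ) = a + 1) (ha : b a = false)
    (hc : b c = true) :
    IsArc b a c ∧ ∀ i j, IsArc b i j → (i = a ∨ j = a ∨ i = c ∨ j = c) → i = a ∧ j = c := by
  have e1 := prefixSum_succ b a
  have e2 := prefixSum_succ b c
  rw [ha] at e1
  rw [hc, hac] at e2
  simp only [sgn, if_true, Bool.false_eq_true, if_false] at e1 e2
  have key : ∀ j, IsArc b a j → j = c := by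
    intro j h
    rw [isArc_iff] at h
    obtain ⟨h1, -, -, -, h5⟩ := h
    by_contra hne
    have h6 : c < j := by
      rw [Fin.lt_def] at h1 ⊢
      have : (j : ℕ) ≠ c := fun h => hne (Fin.ext h)
      omega
    have := h5 c (by rw [Fin.le_def]; omega) h6
    rw [hac] at this
    omega
  constructor
  · rw [isArc_iff]
    refine ⟨by rw [Fin.lt_def]; omega, ha, hc, by rw [hac]; omega, fun m hm hm' => ?_⟩
    rw [Fin.le_def] at hm
    rw [Fin.lt_def] at hm'
    have : (m : ℕ) = a := by omega
    rw [this]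
    omega
  · rintro i j h (rfl | rfl | rfl | rfl)
    · exact ⟨rfl, key j h⟩
    · have := h.2.2.1
      rw [ha] at this
      cases this
    · have := h.2.1
      rw [hc] at this
      cases this
    · refine ⟨?_, rfl⟩
      rw [isArc_iff] at h
      obtain ⟨h1, -, -, h4, h5⟩ := h
      by_contra hne
      rw [Fin.lt_def] at h1
      have : (i : ℕ) ≠ a := fun h => hne (Fin.ext h)
      -- An arc from $i<a$ to $c$ would require the prefix sum before $a$ to lie below its starting
      -- level, but the pair $-+$ returns it to the same value.
      have := h5 ⟨a - 1, by omega⟩ (by rw [Fin.le_def]; simp; omega)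
        (by rw [Fin.lt_def]; simp; omega)
      rw [hac] at h4
      simp only [Nat.sub_add_cancel (by omega : 1 ≤ (a : ℕ))] at this
      omega

theorem isUnpaired_last {b : Str N} (h : b (site N N) = false) : IsUnpaired b (site N N) := by
  refine fun j => ⟨fun hj => ?_, fun hj => ?_⟩
  · have := hj.1
    rw [Fin.lt_def, site_val NeZero.one_le le_rfl] at this
    omega
  · have := hj.2.2.1
    rw [h] at this
    cases this

theorem downIndex_last {b : Str N} (h : b (site N N) = false) : downIndex b (site N N) = 1 := by
  rw [downIndex, Finset.card_eq_one]
  refine ⟨site N N, ?_⟩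
  ext k
  simp only [Finset.mem_filter, Finset.mem_univ, true_and, Finset.mem_singleton]
  constructor
  · rintro ⟨h1, -⟩
    rw [Fin.le_def, site_val NeZero.one_le le_rfl] at h1
    apply Fin.ext
    rw [site_val NeZero.one_le le_rfl]
    omega
  · rintro rfl
    exact ⟨le_rfl, h, isUnpaired_last h⟩

theorem isUnpaired_penultimate {b : Str N} (hN : 2 ≤ N) (h : b (site N N) = false)
    (h' : b (site N (N - 1)) = false) : IsUnpaired b (site N (N - 1)) := by
  refine fun j => ⟨fun hj => ?_, fun hj => ?_⟩
  · have h1 := hj.1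
    rw [Fin.lt_def, site_val (by omega) (by omega)] at h1
    have h2 : j = site N N := by
      apply Fin.ext
      rw [site_val (by omega) le_rfl]
      omega
    have := hj.2.2.1
    rw [h2, h] at this
    cases this
  · have := hj.2.2.1
    rw [h'] at this
    cases this

theorem downIndex_penultimate {b : Str N} (hN : 2 ≤ N) (h : b (site N N) = false)
    (h' : b (site N (N - 1)) = false) : downIndex b (site N (N - 1)) = 2 := by
  rw [downIndex, Finset.card_eq_two]
  refine ⟨site N (N - 1), site N N,
    site_ne (by omega) (by omega) (by omega) le_rfl (by omega), ?_⟩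
  ext k
  simp only [Finset.mem_filter, Finset.mem_univ, true_and, Finset.mem_singleton,
    Finset.mem_insert]
  constructor
  · rintro ⟨h1, -⟩
    rw [Fin.le_def, site_val (by omega) (by omega)] at h1
    rw [Fin.ext_iff, Fin.ext_iff, site_val (by omega) (by omega), site_val (by omega) le_rfl]
    omega
  · rintro (rfl | rfl)
    · exact ⟨le_rfl, h', isUnpaired_penultimate hN h h'⟩
    · refine ⟨?_, h, isUnpaired_last h⟩
      rw [Fin.le_def, site_val (by omega) (by omega), site_val (by omega) le_rfl]
      omega

end Arcs

/-! ### Functionals on the Kazhdan–Lusztig basis -/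

section Dot

variable {K : Type*} [Field K] {N : ℕ}

theorem klBasis_arc (p : Params K) {b : Str N} {a c : Fin N} (h : IsArc b a c) (ε : Str N) :
    klBasis p b ε = arcWeight p (ε a) (ε c)
      * ((∏ x ∈ Finset.univ.erase (a, c), if IsArc b x.1 x.2 then arcWeight p (ε x.1) (ε x.2) else 1)
        * ∏ i, if IsUnpaired b i then
            (if b i = false then downWeight p (downIndex b i) (ε i)
              else if ε i = true then 1 else 0)
          else 1) := by
  rw [klBasis, ← Fintype.prod_prod_type', ← Finset.mul_prod_erase _ _ (Finset.mem_univ (a, c)),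
    if_pos h, mul_assoc]

theorem klBasis_eq_zero_of_arc (p : Params K) {b : Str N} {a c : Fin N} (h : IsArc b a c)
    {ε : Str N} (hε : ε a = ε c) : klBasis p b ε = 0 := by
  rw [klBasis_arc p h, hε]
  cases ε c <;> simp [arcWeight]

theorem klBasis_comp_swap (p : Params K) [NeZero N] {b : Str N} {a c : Fin N}
    (hac : (c : ℕ) = a + 1) (ha : b a = false) (hc : b c = true) {ε : Str N} (hεa : ε a = false)
    (hεc : ε c = true) :
    klBasis p b (ε ∘ Equiv.swap a c) = -(p.q : K)⁻¹ * klBasis p b ε := by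
  obtain ⟨h1, h2⟩ := isArc_adjacent hac ha hc
  rw [klBasis_arc p h1, klBasis_arc p h1]
  simp only [Function.comp_apply, Equiv.swap_apply_left, Equiv.swap_apply_right, hεa, hεc,
    arcWeight, one_mul]
  congr 2
  · refine Finset.prod_congr rfl fun x hx => ?_
    split_ifs with hx'
    · have h3 := h2 x.1 x.2 hx'
      have h4 : ¬(x.1 = a ∧ x.2 = c) := fun h => by
        simp [Prod.ext_iff, h.1, h.2] at hx
      have h5 : ¬(x.1 = a ∨ x.2 = a ∨ x.1 = c ∨ x.2 = c) := fun h => h4 (h3 h)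
      push Not at h5
      rw [Equiv.swap_apply_of_ne_of_ne h5.1 h5.2.2.1, Equiv.swap_apply_of_ne_of_ne h5.2.1 h5.2.2.2]
    · rfl
  · refine Finset.prod_congr rfl fun i _ => ?_
    by_cases hi : IsUnpaired b i
    · have hia : i ≠ a := by
        rintro rfl
        exact (hi c).1 h1
      have hic : i ≠ c := by
        rintro rfl
        exact (hi a).2 h1
      simp only [Equiv.swap_apply_of_ne_of_ne hia hic]
    · simp [hi]

theorem klBasis_update_true (p : Params K) {b : Str N} {c : Fin N} (hc : b c = false)
    (hu : IsUnpaired b c) {ε : Str N} (hε : ε c = false) :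
    klBasis p b (Function.update ε c true)
      = downWeight p (downIndex b c) true * klBasis p b ε := by
  have e1 : ∀ i j, (if IsArc b i j then arcWeight p (Function.update ε c true i)
      (Function.update ε c true j) else 1)
      = if IsArc b i j then arcWeight p (ε i) (ε j) else 1 := by
    intro i j
    split_ifs with h
    · have hi : i ≠ c := by
        rintro rfl
        exact (hu j).1 h
      have hj : j ≠ c := by
        rintro rfl
        exact (hu i).2 h
      simp [hi, hj]
    · rfl
  have e2 : ∀ i ∈ Finset.univ.erase c, (if IsUnpaired b i then
      (if b i = false then downWeight p (downIndex b i) (Function.update ε c true i)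
        else if Function.update ε c true i = true then 1 else 0) else 1)
      = if IsUnpaired b i then (if b i = false then downWeight p (downIndex b i) (ε i)
        else if ε i = true then 1 else 0) else 1 := by
    intro i hi
    simp only [Function.update_of_ne (Finset.ne_of_mem_erase hi)]
  simp only [klBasis, e1]
  generalize (∏ i, ∏ j, if IsArc b i j then arcWeight p (ε i) (ε j) else 1) = r
  rw [← Finset.mul_prod_erase _ _ (Finset.mem_univ c), Finset.prod_congr rfl e2,
    ← Finset.mul_prod_erase _ _ (Finset.mem_univ c)]
  simp only [if_pos hu, if_pos hc, Function.update_self, hε, downWeight]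
  ring

theorem klBasis_self (p : Params K) (b : Str N) : klBasis p b b = 1 := by
  rw [klBasis, Finset.prod_eq_one, Finset.prod_eq_one, one_mul]
  · intro i _
    split_ifs with h1 h2 h3
    · simp [h2, downWeight]
    · rfl
    · simp at h2
      exact absurd h2 h3
    · rfl
  · intro i _
    refine Finset.prod_eq_one fun j _ => ?_
    split_ifs with h
    · rw [h.2.1, h.2.2.1]
      rfl
    · rfl

variable {M : Type*} [AddCommGroup M] [Module K M]

/-- The value of a functional at the Kazhdan–Lusztig basis vector `C_b`. -/
noncomputable def dot (p : Params K) (w : Str N → M) (b : Str N) : M := ∑ ε, klBasis p b ε • w ε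

/-- The arc factor is contracted first, leaving the combination $w_{-+}-q^{-1}w_{+-}$;
`dot_eq_of_unpaired` does the same for an unjoined $-$. -/
theorem dot_eq_of_adjacent (p : Params K) [NeZero N] {b : Str N} {a c : Fin N}
    (hac : (c : ℕ) = a + 1) (ha : b a = false) (hc : b c = true) (w : Str N → M) :
    dot p w b = ∑ ε, if ε a = false ∧ ε c = true then
      klBasis p b ε • (w ε - (p.q : K)⁻¹ • w (ε ∘ Equiv.swap a c)) else 0 := by
  have h1 := (isArc_adjacent hac ha hc).1
  let σ : Str N ≃ Str N := Function.Involutive.toPerm (fun ε => ε ∘ Equiv.swap a c) fun ε => by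
    funext k
    simp
  have hσ : ∀ ε, σ ε = ε ∘ Equiv.swap a c := fun _ => rfl
  have e : ∀ ε, klBasis p b ε • w ε
      = (if ε a = false ∧ ε c = true then klBasis p b ε • w ε else 0)
        + if ε a = true ∧ ε c = false then klBasis p b ε • w ε else 0 := by
    intro ε
    by_cases h : ε a = ε c
    · rw [klBasis_eq_zero_of_arc p h1 h]
      simp
    · revert h
      cases ε a <;> cases ε c <;> simp
  rw [dot, Finset.sum_congr rfl fun ε _ => e ε, Finset.sum_add_distrib,
    ← Equiv.sum_comp σ fun ε => if ε a = true ∧ ε c = false then klBasis p b ε • w ε else 0,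
    ← Finset.sum_add_distrib]
  refine Finset.sum_congr rfl fun ε _ => ?_
  rw [hσ]
  simp only [Function.comp_apply, Equiv.swap_apply_left, Equiv.swap_apply_right]
  by_cases h : ε a = false ∧ ε c = true
  · rw [if_pos h, if_pos h.symm, if_pos h, klBasis_comp_swap p hac ha hc h.1 h.2]
    simp only [smul_sub, smul_smul]
    rw [sub_eq_add_neg, ← neg_smul]
    congr 2
    ring
  · rw [if_neg h, if_neg (by tauto), if_neg h, add_zero]

theorem dot_eq_of_unpaired (p : Params K) {b : Str N} {c : Fin N} (hc : b c = false)
    (hu : IsUnpaired b c) (w : Str N → M) :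
    dot p w b = ∑ ε, if ε c = false then klBasis p b ε •
      (w ε + downWeight p (downIndex b c) true • w (Function.update ε c true)) else 0 := by
  let σ : Str N ≃ Str N :=
    Function.Involutive.toPerm (fun ε => Function.update ε c (!ε c)) fun ε => by simp
  have hσ : ∀ ε, σ ε = Function.update ε c (!ε c) := fun _ => rfl
  have e : ∀ ε, klBasis p b ε • w ε
      = (if ε c = false then klBasis p b ε • w ε else 0)
        + if ε c = true then klBasis p b ε • w ε else 0 := by
    intro ε
    cases ε c <;> simp
  rw [dot, Finset.sum_congr rfl fun ε _ => e ε, Finset.sum_add_distrib,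
    ← Equiv.sum_comp σ fun ε => if ε c = true then klBasis p b ε • w ε else 0,
    ← Finset.sum_add_distrib]
  refine Finset.sum_congr rfl fun ε _ => ?_
  rw [hσ]
  by_cases h : ε c = false
  · simp only [h, Bool.not_false, Function.update_self, if_true,
      klBasis_update_true p hc hu h, smul_add, smul_smul, mul_comm]
  · simp [h]

end Dot
/-! ### Values of product functionals -/

section Values

variable {K : Type*} [Field K] {N : ℕ} [NeZero N] {S : Type*} [CommRing S] [Algebra K S]

/-- The functional `w` is supported on strings that start with `n` letters `-`. -/
def HasHead (n : ℕ) (w : Str N → S) : Prop :=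
  ∀ j, 1 ≤ j → j ≤ n → ∀ ε, ε (site N j) = true → w ε = 0

theorem tailWeight_succ {N : ℕ} (p : Params K) (τ : S) {j : ℕ} (hj : j < N) :
    tailWeight p N τ j = (p.q : K)⁻¹ • tailWeight p N τ (j + 1) := by
  rw [tailWeight, tailWeight, smul_smul, show N - j = N - (j + 1) + 1 by omega, pow_succ]
  congr 1
  ring

theorem tailWeight_last {N : ℕ} (p : Params K) (τ : S) : tailWeight p N τ N = (p.κN : K) • τ := by
  simp [tailWeight]

theorem HasTail.swap {p : Params K} {τ : S} {n : ℕ} {w : Str N → S} (hw : HasTail p τ n w) {j : ℕ}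
    (hj : n < j) (hjN : j < N) (ε : Str N) :
    w (Function.update (Function.update ε (site N j) false) (site N (j + 1)) true)
      = (p.q : K)⁻¹
        • w (Function.update (Function.update ε (site N j) true) (site N (j + 1)) false) := by
  have hne : site N j ≠ site N (j + 1) :=
    site_ne (by omega) hjN.le (by omega) hjN (by omega)
  rw [hw (j + 1) (by omega) hjN, Function.update_comm hne, hw j hj hjN.le, tailWeight_succ p τ hjN,
    Function.update_comm hne, Algebra.smul_mul_assoc]

theorem HasHead.swap (p : Params K) {n : ℕ} {w : Str N → S} (hw : HasHead n w) {j : ℕ}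
    (h1 : 1 ≤ j) (hj : j < n) (hn : n ≤ N) (ε : Str N) :
    w (Function.update (Function.update ε (site N j) false) (site N (j + 1)) true)
      = (p.q : K)⁻¹
        • w (Function.update (Function.update ε (site N j) true) (site N (j + 1)) false) := by
  have hne : site N j ≠ site N (j + 1) :=
    site_ne (by omega) (by omega) (by omega) (by omega) (by omega)
  rw [hw (j + 1) (by omega) hj _ (by simp), hw j h1 hj.le _ (by simp [hne]), smul_zero]

/-- The hypothesis says that $w$ annihilates the image of $e_{ac}$, which is spanned by the arc
vectors. Tails satisfy it by the ratio $q^{-1}$ of consecutive weights, heads because both sides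
vanish. -/
theorem braidAct_eq_smul {N : ℕ} {p : Params K} {a c : Fin N} (hac : a ≠ c) {w : Str N → S}
    (hw : ∀ ε, w (Function.update (Function.update ε a false) c true)
      = (p.q : K)⁻¹ • w (Function.update (Function.update ε a true) c false)) :
    braidAct p a c w = fun ε => (p.q : K)⁻¹ • w ε := by
  funext ε
  obtain ⟨x, y, hε⟩ : ∃ x y, ε = Function.update (Function.update ε a x) c y :=
    ⟨ε a, ε c, by simp⟩
  rw [hε, braidAct_update_update p hac]
  cases x <;> cases y
  · simp
  · simp only [hw, smul_smul, reduceCtorEq, if_false]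
    have e : ((p.q : K)⁻¹ - p.q) * (p.q : K)⁻¹ = (p.q : K)⁻¹ * (p.q : K)⁻¹ - 1 := by
      rw [sub_mul, mul_inv_cancel₀ p.q.ne_zero]
    rw [e]
    module
  · simp [hw]
  · simp

theorem HasTail.act_last {p : Params K} {τ : S}
    (hτ : (τ - algebraMap K S (p.qN : K)⁻¹) * (τ + algebraMap K S p.qN) = 0)
    {n : ℕ} (hn : n < N) {w : Str N → S} (hw : HasTail p τ n w) :
    act p N w = fun ε => τ * w ε := by
  have hκ : algebraMap K S p.κN * algebraMap K S (p.κN : K)⁻¹ = 1 := by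
    rw [← map_mul, mul_inv_cancel₀ p.κN.ne_zero, map_one]
  have hN : algebraMap K S p.qN * algebraMap K S (p.qN : K)⁻¹ = 1 := by
    rw [← map_mul, mul_inv_cancel₀ p.qN.ne_zero, map_one]
  funext ε
  obtain ⟨x, hε⟩ : ∃ x, ε = Function.update ε (site N N) x := ⟨ε (site N N), by simp⟩
  rw [hε, act, if_neg (lt_irrefl N), boundaryAct_update]
  have h := hw N hn le_rfl ε
  rw [tailWeight_last] at h
  cases x
  · simp only [h, Algebra.smul_def, map_sub, Bool.false_eq_true, if_false]
    linear_combination -(algebraMap K S p.κN * w (Function.update ε (site N N) true)) * (hτ + hN)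
  · simp only [h, Algebra.smul_def, if_true]
    linear_combination τ * w (Function.update ε (site N N) true) * hκ

/-- The values of $wJ_n$ are combinations of values of $w$ that differ only in the letter $n$, so
every tail relation is inherited. -/
theorem HasTail.jucysMurphy {p : Params K} {τ : S}
    (hτ : (τ - algebraMap K S (p.qN : K)⁻¹) * (τ + algebraMap K S p.qN) = 0)
    {n : ℕ} (h1 : 1 ≤ n) (hn : n < N) {w : Str N → S} (hw : HasTail p τ n w) :
    HasTail p τ n (jucysMurphy p (N - n) w) := by
  intro j hj hjN ε
  have e : N - (N - n) = n := by omega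
  have h := jucysMurphy_update hτ (N := N) (m := N - n) (by omega) (w := w) (by rwa [e])
  rw [e] at h
  have hne : site N n ≠ site N j := site_ne h1 hn.le (by omega) hjN (by omega)
  obtain ⟨x, hε⟩ : ∃ x, ε = Function.update ε (site N n) x := ⟨ε (site N n), by simp⟩
  rw [hε, Function.update_comm hne, Function.update_comm hne]
  have hwj := fun x => hw j hj hjN (Function.update ε (site N n) x)
  simp only [Function.update_comm hne] at hwj
  cases x
  · rw [(h _).2, (h _).2, hwj, hwj, mul_add, mul_smul_comm]
    ring
  · rw [(h _).1, (h _).1, hwj, mul_smul_comm]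

theorem HasTail.jucysMurphy_of_lt {p : Params K} {τ : S}
    (hτ : (τ - algebraMap K S (p.qN : K)⁻¹) * (τ + algebraMap K S p.qN) = 0)
    {n : ℕ} {w : Str N → S} (hw : HasTail p τ n w) {m : ℕ} (hm : n + m < N) :
    OneBoundaryQKZ.jucysMurphy p m w = fun ε => ((p.q : K)⁻¹ ^ (2 * m) • τ) * w ε := by
  induction m with
  | zero => simpa [OneBoundaryQKZ.jucysMurphy] using hw.act_last hτ hm
  | succ m ih =>
    have hi : N - (m + 1) < N := by omega
    -- The scalar is written as a linear map so that it can be pulled through the remaining action.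
    have h1 : act p (N - (m + 1)) w = fun ε => LinearMap.lsmul K S (p.q : K)⁻¹ (w ε) := by
      rw [act, if_pos hi, braidAct_eq_smul
        (site_ne (by omega) hi.le (by omega) (by omega) (by omega)) (hw.swap (by omega) hi)]
      rfl
    have h2 : OneBoundaryQKZ.jucysMurphy p m w
        = fun ε => LinearMap.mulLeft K ((p.q : K)⁻¹ ^ (2 * m) • τ) (w ε) := ih (by omega)
    rw [OneBoundaryQKZ.jucysMurphy, h1, jucysMurphy_comp, h2, act_comp, act_comp, h1]
    funext ε
    simp only [LinearMap.mulLeft_apply, LinearMap.lsmul_apply, mul_smul_comm, smul_mul_assoc,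
      smul_smul]
    congr 1
    ring

theorem HasTail.dot_eq_zero_of_adjacent {p : Params K} {τ : S} {n : ℕ} {w : Str N → S}
    (hw : HasTail p τ n w) {b : Str N} {j : ℕ} (hj : n < j) (hjN : j < N)
    (h1 : b (site N j) = false) (h2 : b (site N (j + 1)) = true) : dot p w b = 0 := by
  rw [dot_eq_of_adjacent p (by rw [site_val (by omega) hjN, site_val (by omega) hjN.le]; omega)
    h1 h2]
  refine Finset.sum_eq_zero fun ε _ => ?_
  split_ifs with h
  · have e : ε = Function.update (Function.update ε (site N j) false) (site N (j + 1)) true := by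
      rw [← h.1, Function.update_eq_self, ← h.2, Function.update_eq_self]
    have hne : site N j ≠ site N (j + 1) :=
      site_ne (by omega) hjN.le (by omega) hjN (by omega)
    rw [e, hw.swap hj hjN, update_update_comp_swap hne, sub_self, smul_zero]
  · rfl

/-- The value of a product functional at a basis vector whose last letter is `-`. -/
theorem HasTail.dot_last {p : Params K} {τ : S} {n : ℕ} (hn : n < N) {w : Str N → S}
    (hw : HasTail p τ n w) {b : Str N} (h : b (site N N) = false) :
    dot p w b = ∑ ε, if ε (site N N) = false then klBasis p b ε •
      ((p.κN : K) • (τ - algebraMap K S (p.qN : K)⁻¹)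
        * w (Function.update ε (site N N) true)) else 0 := by
  rw [dot_eq_of_unpaired p h (isUnpaired_last h), downIndex_last h]
  refine Finset.sum_congr rfl fun ε _ => ?_
  split_ifs with hε
  · have e : w ε = (p.κN : K) • τ * w (Function.update ε (site N N) true) := by
      conv_lhs => rw [← Function.update_eq_self (site N N) ε, hε, hw N hn le_rfl, tailWeight_last]
    rw [e]
    congr 1
    simp only [downWeight, odd_one, if_true, Algebra.smul_def, map_neg, map_mul]
    ring
  · rfl

/-- The two last letters are unjoined with numbers $1$ and $2$ and contribute
$\kappa_N(\tau-q_N^{-1})$ and $\kappa_Nq^{-1}(\tau+q_N)$, whose product is zero. -/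
theorem HasTail.dot_eq_zero_of_last_two {p : Params K} {τ : S}
    (hτ : (τ - algebraMap K S (p.qN : K)⁻¹) * (τ + algebraMap K S p.qN) = 0)
    {n : ℕ} (hn : n + 1 < N) {w : Str N → S}
    (hw : HasTail p τ n w) {b : Str N} (h : b (site N N) = false)
    (h' : b (site N (N - 1)) = false) : dot p w b = 0 := by
  have hne : site N (N - 1) ≠ site N N :=
    site_ne (by omega) (by omega) (by omega) le_rfl (by omega)
  -- The contraction of the last letter is recast as a new functional, so that the letter before it
  -- can be contracted by the same lemma.
  have e : dot p w b = dot p (fun ε => if ε (site N N) = false then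
      (p.κN : K) • (τ - algebraMap K S (p.qN : K)⁻¹)
        * w (Function.update ε (site N N) true) else 0) b := by
    rw [hw.dot_last (by omega) h, dot]
    refine Finset.sum_congr rfl fun ε _ => ?_
    split_ifs <;> simp
  rw [e, dot_eq_of_unpaired p h' (isUnpaired_penultimate (by omega) h h'),
    downIndex_penultimate (by omega) h h']
  refine Finset.sum_eq_zero fun ε _ => ?_
  by_cases hε : ε (site N (N - 1)) = false
  swap
  · rw [if_neg hε]
  rw [if_pos hε]
  by_cases hN : ε (site N N) = false
  · have hN' : Function.update ε (site N (N - 1)) true (site N N) = false := by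
      rwa [Function.update_of_ne hne.symm]
    have e1 : w (Function.update ε (site N N) true)
        = ((p.κN : K) * (p.q : K)⁻¹) • τ
          * w (Function.update (Function.update ε (site N (N - 1)) true) (site N N) true) := by
      have e0 : Function.update ε (site N N) true
          = Function.update (Function.update ε (site N N) true) (site N (N - 1)) false := by
        rw [← hε, Function.update_comm hne.symm, Function.update_eq_self]
      rw [e0, hw (N - 1) (by omega) (by omega), Function.update_comm hne.symm,
        tailWeight, show N - (N - 1) = 1 by omega, pow_one]
    rw [if_pos hN, if_pos hN', e1]
    simp only [downWeight, show ¬ Odd 2 by decide, if_false, Algebra.smul_def, map_mul]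
    linear_combination algebraMap K S (klBasis p b ε) * algebraMap K S p.κN ^ 2
      * algebraMap K S (p.q : K)⁻¹
      * w (Function.update (Function.update ε (site N (N - 1)) true) (site N N) true) * hτ
  · rw [if_neg hN, if_neg (by rwa [Function.update_of_ne hne.symm])]
    simp

/-- A product functional detects only strings without `-+` in the tail, so that a letter `+` in the
tail is preceded by letters `+` only. -/
theorem HasTail.eq_true_of_dot_ne_zero {p : Params K} {τ : S} {n : ℕ} {w : Str N → S}
    (hw : HasTail p τ n w) {b : Str N} (hb : dot p w b ≠ 0) {k : ℕ} (hk : k ≤ N)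
    (hbk : b (site N k) = true) {j : ℕ} (hj : n < j) (hjk : j ≤ k) : b (site N j) = true := by
  induction hjk using Nat.decreasingInduction with
  | self => exact hbk
  | of_succ j hjk ih =>
    by_contra h
    rw [Bool.not_eq_true] at h
    exact hb (hw.dot_eq_zero_of_adjacent hj (by omega) h (ih (by omega)))

/-- On the arc joining $n$ and $n+1$, the diagonal entry of $J_n$ gives $q^{-2m}\tau+\tau'$ with
$m=N-n$. The off-diagonal entry, acting on the $v_{+-}$ part of the arc, gives $-q^{-2m}\tau$, so
only $\tau'$ remains. -/
theorem dot_jucysMurphy {p : Params K} {τ : S}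
    (hτ : (τ - algebraMap K S (p.qN : K)⁻¹) * (τ + algebraMap K S p.qN) = 0)
    {n : ℕ} (h1 : 1 ≤ n) (hn : n < N) {w : Str N → S} (hw : HasTail p τ n w) (hh : HasHead n w)
    {b : Str N} (hb : b (site N n) = false) (hb' : b (site N (n + 1)) = true) :
    dot p (jucysMurphy p (N - n) w) b
      = -(τ - algebraMap K S ((p.qN : K)⁻¹ - p.qN)) * dot p w b := by
  have hac : (site N (n + 1) : ℕ) = site N n + 1 := by
    rw [site_val (by omega) hn, site_val h1 hn.le]
    omega
  have hne : site N n ≠ site N (n + 1) := site_ne h1 hn.le (by omega) hn (by omega)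
  have e : N - (N - n) = n := by omega
  have h := jucysMurphy_update hτ (N := N) (m := N - n) (by omega) (w := w) (by rwa [e])
  rw [e] at h
  have hκ : algebraMap K S p.κN * algebraMap K S (p.κN : K)⁻¹ = 1 := by
    rw [← map_mul, mul_inv_cancel₀ p.κN.ne_zero, map_one]
  rw [dot_eq_of_adjacent p hac hb hb', dot_eq_of_adjacent p hac hb hb', Finset.mul_sum]
  refine Finset.sum_congr rfl fun ε _ => ?_
  rw [mul_ite, mul_zero]
  split_ifs with hε
  · have e1 : ε = Function.update (Function.update ε (site N (n + 1)) true) (site N n) false := by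
      rw [← hε.2, Function.update_eq_self, ← hε.1, Function.update_eq_self]
    have e2 : ε ∘ Equiv.swap (site N n) (site N (n + 1))
        = Function.update (Function.update ε (site N (n + 1)) false) (site N n) true := by
      conv_lhs => rw [e1, Function.update_comm hne.symm, update_update_comp_swap hne,
        Function.update_comm hne]
    have e3 : w (Function.update (Function.update ε (site N (n + 1)) false) (site N n) false)
        = tailWeight p N τ (n + 1) * w ε := by
      rw [Function.update_comm hne.symm, hw (n + 1) (by omega) hn, Function.update_comm hne, ← e1]
    have z1 : w (Function.update (Function.update ε (site N (n + 1)) true) (site N n) true) = 0 :=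
      hh n h1 le_rfl _ (by simp)
    have z2 : w (Function.update (Function.update ε (site N (n + 1)) false) (site N n) true) = 0 :=
      hh n h1 le_rfl _ (by simp)
    have f1 := (h (Function.update ε (site N (n + 1)) true)).2
    rw [← e1, z1] at f1
    -- The three summands of the exponent come from the off-diagonal entry, the tail weight at $n+1$
    -- and the arc.
    rw [f1, e2, (h _).1, e3, z2, tailWeight, show 2 * (N - n) = (N - n) + (N - (n + 1)) + 1 by omega]
    simp only [Algebra.smul_def, map_mul, map_pow]
    linear_combination -(algebraMap K S (klBasis p b ε)
      * algebraMap K S (p.q : K)⁻¹ ^ (N - n + (N - (n + 1)) + 1) * τ * w ε) * hκ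
  · rfl

/-- The product functional with `n` factors `v_-^*`, followed by the factors
`v_+^* + tailWeight p N τ j • v_-^*`. -/
noncomputable def productFunctional (p : Params K) (τ : S) (n : ℕ) : Str N → S := fun ε =>
  ∏ j : Fin N, if (j : ℕ) < n then (if ε j then 0 else 1)
    else if ε j then 1 else tailWeight p N τ (j + 1)

theorem hasHead_productFunctional (p : Params K) (τ : S) {n : ℕ} (hn : n ≤ N) :
    HasHead (N := N) n (productFunctional p τ n) := by
  intro j h1 hj ε hε
  refine Finset.prod_eq_zero (Finset.mem_univ (site N j)) ?_
  rw [if_pos (by rw [site_val h1 (by omega)]; omega), if_pos hε]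

theorem hasTail_productFunctional (p : Params K) (τ : S) (n : ℕ) :
    HasTail (N := N) p τ n (productFunctional p τ n) := by
  intro j hj hjN ε
  have hv := site_val (N := N) (by omega : 1 ≤ j) hjN
  simp only [productFunctional]
  rw [← Finset.mul_prod_erase _ _ (Finset.mem_univ (site N j)),
    ← Finset.mul_prod_erase Finset.univ _ (Finset.mem_univ (site N j))]
  simp only [Function.update_self, hv, Nat.sub_add_cancel (by omega : 1 ≤ j),
    if_neg (by omega : ¬ j - 1 < n), if_true,
    Bool.false_eq_true, if_false, one_mul]
  congr 1
  refine Finset.prod_congr rfl fun k hk => ?_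
  simp only [Function.update_of_ne (Finset.ne_of_mem_erase hk)]

theorem productFunctional_eq_one (p : Params K) (τ : S) {n : ℕ} {ε : Str N}
    (h1 : ∀ j, 1 ≤ j → j ≤ n → ε (site N j) = false)
    (h2 : ∀ j, n < j → j ≤ N → ε (site N j) = true) : productFunctional p τ n ε = 1 := by
  refine Finset.prod_eq_one fun k _ => ?_
  split_ifs with h3 h4 h5
  · have := h1 (k + 1) (by omega) (by omega)
    rw [site_succ_val, h4] at this
    cases this
  · rfl
  · rfl
  · have := h2 (k + 1) (by omega) (by omega)
    rw [site_succ_val] at this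
    exact absurd this h5

end Values

/-! ### Eigenvalues of `Ŷ_i` on components -/

section Eigen

variable {K : Type*} [Field K] {N : ℕ} [NeZero N] {S : Type*} [CommRing S] [Algebra K S]

theorem dot_comp {N : ℕ} {p : Params K} (ℓ : S →ₗ[K] K) (w : Str N → S) (b : Str N) :
    dot p (fun ε => ℓ (w ε)) b = ℓ (dot p w b) := by
  simp [dot]

theorem pair_total {N : ℕ} (p : Params K) (Ψ : Ballot N → RatFn K N) (w : Str N → K) :
    pair w (total p Ψ) = ∑ b, dot p w b.1 • Ψ b := by
  simp only [pair, total, dot, Finset.smul_sum, Finset.sum_smul]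
  rw [Finset.sum_comm]
  refine Finset.sum_congr rfl fun b _ => Finset.sum_congr rfl fun ε _ => ?_
  rw [mul_comm (Ψ b), ← Algebra.smul_def, smul_smul, smul_eq_mul, mul_comm]

theorem pair_eq_smul {N : ℕ} {p : Params K} (Ψ : Ballot N → RatFn K N) (ℓ : S →ₗ[K] K) {w : Str N → S}
    {β : Ballot N} (h : ∀ b : Ballot N, b ≠ β → dot p w b.1 = 0) :
    pair (fun ε => ℓ (w ε)) (total p Ψ) = ℓ (dot p w β.1) • Ψ β := by
  rw [pair_total, Fintype.sum_eq_single β]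
  · rw [dot_comp]
  · intro b hb
    rw [dot_comp, h b hb, map_zero, zero_smul]

/-- By `hv` and `hℓ`, the component $\Psi_\beta$ is the pairing of $\Psi$ with $\ell\circ w$. As
$\tau$ need not lie in $K$, $\ell$ is applied only after $J_i$ has acted, and `hτ₀` records the
resulting eigenvalue. -/
theorem Yhat_eigen_tail {p : Params K} {Ψ : Ballot N → RatFn K N} (hΨ : IsSolution p Ψ) {τ : S}
    (hτ : (τ - algebraMap K S (p.qN : K)⁻¹) * (τ + algebraMap K S p.qN) = 0)
    {ℓ : S →ₗ[K] K} {β : Ballot N} {n : ℕ} {w : Str N → S} (hw : HasTail p τ n w)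
    (hv : ∀ v : Str N → S, HasTail p τ n v → ∀ b : Ballot N, b ≠ β → dot p v b.1 = 0)
    (hℓ : ℓ (dot p w β.1) = 1) {τ₀ : K} (hτ₀ : ℓ (τ * dot p w β.1) = τ₀) {i : ℕ} (hn : n < i)
    (hi : i ≤ N) :
    Yhat p N i (Ψ β) = (-(p.q0 : K) * ((p.q : K)⁻¹ ^ (2 * (N - i)) * τ₀)) • Ψ β := by
  have h0 : Ψ β = pair (fun ε => ℓ (w ε)) (total p Ψ) := by
    rw [pair_eq_smul Ψ ℓ (hv w hw), hℓ, one_smul]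
  have h1 : ∀ b : Str N, dot p (jucysMurphy p (N - i) w) b
      = (p.q : K)⁻¹ ^ (2 * (N - i)) • (τ * dot p w b) := fun b => by
    rw [hw.jucysMurphy_of_lt hτ (by omega)]
    simp only [dot, Finset.mul_sum, Finset.smul_sum]
    refine Finset.sum_congr rfl fun ε _ => ?_
    rw [smul_mul_assoc, mul_smul_comm, smul_comm]
  have h2 := Yhat_pair hΨ (fun ε => ℓ (w ε)) (m := N - i) (by omega)
  rw [show N - (N - i) = i by omega, ← h0, jucysMurphy_comp, pair_eq_smul (β := β), h1, map_smul,
    hτ₀, smul_smul] at h2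
  · exact h2
  · intro b hb
    rw [h1, hv w hw b hb, mul_zero, smul_zero]

theorem That_eigen_head {p : Params K} {Ψ : Ballot N → RatFn K N} (hΨ : IsSolution p Ψ)
    {ℓ : S →ₗ[K] K} {n : ℕ} (hn : n ≤ N) {w : Str N → S} (hh : HasHead n w) {i : ℕ} (hi : 1 ≤ i)
    (hin : i < n) :
    That p N i (pair (fun ε => ℓ (w ε)) (total p Ψ))
      = (p.q : K)⁻¹ • pair (fun ε => ℓ (w ε)) (total p Ψ) := by
  rw [That_pair hΨ hi (by omega), act_comp, act, if_pos (by omega),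
    braidAct_eq_smul (site_ne hi (by omega) (by omega) (by omega) (by omega)) (hh.swap p hi hin hn)]
  simp [pair, Finset.smul_sum, smul_smul]

/-- At $i=n$ the functional $wJ_n$ has lost its head but not its tail, which is why `hv` must cover
all functionals with this tail. Smaller $i$ follow by descent, as $\hat
T_i\Psi_\beta=q^{-1}\Psi_\beta$. -/
theorem Yhat_eigen_head {p : Params K} {Ψ : Ballot N → RatFn K N} (hΨ : IsSolution p Ψ) {τ : S}
    (hτ : (τ - algebraMap K S (p.qN : K)⁻¹) * (τ + algebraMap K S p.qN) = 0)
    {ℓ : S →ₗ[K] K} {β : Ballot N} {n : ℕ} {w : Str N → S} (hw : HasTail p τ n w)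
    (hh : HasHead n w)
    (hv : ∀ v : Str N → S, HasTail p τ n v → ∀ b : Ballot N, b ≠ β → dot p v b.1 = 0)
    (hℓ : ℓ (dot p w β.1) = 1) {τ₀ : K} (hτ₀ : ℓ (τ * dot p w β.1) = τ₀) (hn : n < N)
    (hβ : β.1 (site N n) = false) (hβ' : β.1 (site N (n + 1)) = true) {i : ℕ} (h1 : 1 ≤ i)
    (hi : i ≤ n) :
    Yhat p N i (Ψ β)
      = (p.q0 * ((p.q : K)⁻¹ ^ (2 * (n - i)) * (τ₀ - ((p.qN : K)⁻¹ - p.qN)))) • Ψ β := by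
  have h0 : Ψ β = pair (fun ε => ℓ (w ε)) (total p Ψ) := by
    rw [pair_eq_smul Ψ ℓ (hv w hw), hℓ, one_smul]
  induction hi using Nat.decreasingInduction with
  | self =>
    have h2 := Yhat_pair hΨ (fun ε => ℓ (w ε)) (m := N - n) (by omega)
    rw [show N - (N - n) = n by omega, jucysMurphy_comp,
      pair_eq_smul Ψ ℓ (hv _ (hw.jucysMurphy hτ h1 hn)),
      dot_jucysMurphy hτ h1 hn hw hh hβ hβ', ← h0, smul_smul] at h2
    have e : ℓ (-(τ - algebraMap K S ((p.qN : K)⁻¹ - p.qN)) * dot p w β.1)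
        = -(τ₀ - ((p.qN : K)⁻¹ - p.qN)) := by
      rw [neg_mul, sub_mul, map_neg, map_sub, hτ₀, ← Algebra.smul_def, map_smul, hℓ, smul_eq_mul,
        mul_one]
    rw [h2, e]
    congr 1
    simp only [Nat.sub_self, mul_zero, pow_zero]
    ring
  | of_succ i hi ih =>
    have h2 : That p N i (Ψ β) = (p.q : K)⁻¹ • Ψ β := by
      conv_lhs => rw [h0]
      conv_rhs => rw [h0]
      exact That_eigen_head hΨ hn.le hh h1 hi
    rw [Yhat_eq_That_mul p h1 (by omega), Module.End.mul_apply, Module.End.mul_apply, h2, map_smul,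
      ih (by omega), map_smul, map_smul, h2, smul_smul, smul_smul]
    congr 1
    rw [show 2 * (n - i) = 2 * (n - (i + 1)) + 2 by omega]
    ring

end Eigen

/-! ### The functionals dual to `C_{b₀}` and to `C_{bLast}` -/

section Dual

variable {K : Type*} [Field K] {N : ℕ} [NeZero N]

theorem ext_site {b b' : Str N} (h : ∀ j, 1 ≤ j → j ≤ N → b (site N j) = b' (site N j)) :
    b = b' := by
  funext k
  have := h (k + 1) (by omega) (by omega)
  rwa [site_succ_val] at this

theorem b0_false {j : ℕ} (h1 : 1 ≤ j) (hj : j ≤ (N + 1) / 2) : (b0 N).1 (site N j) = false := by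
  have := NeZero.one_le (n := N)
  simp only [b0, site_val h1 (by omega : j ≤ N), decide_eq_false_iff_not]
  omega

theorem b0_true {j : ℕ} (h1 : (N + 1) / 2 < j) (hj : j ≤ N) : (b0 N).1 (site N j) = true := by
  simp only [b0, site_val (by omega : 1 ≤ j) hj, decide_eq_true_eq]
  omega

theorem bLast_false (hN : Odd N) {j : ℕ} (h1 : 1 ≤ j) (hj : j ≤ (N - 1) / 2) :
    (bLast N hN).1 (site N j) = false := by
  simp only [bLast, site_val h1 (by omega : j ≤ N), decide_eq_false_iff_not]
  omega

theorem bLast_true (hN : Odd N) {j : ℕ} (h1 : (N - 1) / 2 < j) (hj : j ≤ N - 1) :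
    (bLast N hN).1 (site N j) = true := by
  simp only [bLast, site_val (by omega : 1 ≤ j) (by omega : j ≤ N), decide_eq_true_eq]
  omega

theorem bLast_last (hN : Odd N) : (bLast N hN).1 (site N N) = false := by
  simp only [bLast, site_val NeZero.one_le le_rfl, decide_eq_false_iff_not]
  omega

theorem dot_eq_zero_of_ne_b0 {p : Params K} (hN : 2 ≤ N) {v : Str N → K}
    (hv : HasTail p (p.qN : K)⁻¹ ((N + 1) / 2) v) (b : Ballot N) (hb : b ≠ b0 N) :
    dot p v b.1 = 0 := by
  by_contra h
  apply hb
  have hlast : b.1 (site N N) = true := by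
    by_contra hf
    rw [Bool.not_eq_true] at hf
    apply h
    rw [hv.dot_last (by omega) hf]
    simp
  have ht := fun j => hv.eq_true_of_dot_ne_zero h le_rfl hlast (j := j)
  have h1 := prefixSum_of_true (by omega : (N + 1) / 2 ≤ N) ht
  have h2 := b.2.prefixSum_le le_rfl
  -- The $\lfloor N/2\rfloor$ letters $+$ of the tail must be compensated by the first
  -- $\lfloor(N+1)/2\rfloor$ letters, with slack at most $1$.
  have hf := fun j => eq_false_of_prefixSum_le (b := b.1) (k := (N + 1) / 2) (j := j) (by omega)
  refine Subtype.ext (ext_site fun j hj hjN => ?_)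
  rcases le_or_gt j ((N + 1) / 2) with hle | hgt
  · rw [hf j hj hle, b0_false hj hle]
  · rw [ht j hgt hjN, b0_true hgt hjN]

theorem dot_eq_zero_of_ne_bLast {p : Params K} (hN : Odd N) {S : Type*} [CommRing S] [Algebra K S]
    {τ : S} (hτ : (τ - algebraMap K S (p.qN : K)⁻¹) * (τ + algebraMap K S p.qN) = 0)
    {v : Str N → S} (hv : HasTail p τ ((N - 1) / 2) v) (b : Ballot N) (hb : b ≠ bLast N hN) :
    dot p v b.1 = 0 := by
  have hodd := hN
  obtain ⟨n, hn⟩ := hN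
  have hn' : (N - 1) / 2 = n := by omega
  by_contra h
  apply hb
  -- A last letter $+$ would force $n+1$ letters $+$ after only $n$ letters, against the ballot
  -- condition.
  have hlast : b.1 (site N N) = false := by
    by_contra ht
    rw [Bool.not_eq_false] at ht
    have h1 := prefixSum_of_true (by omega : n ≤ N)
      fun j hj hjN => hv.eq_true_of_dot_ne_zero h le_rfl ht (j := j) (by omega) hjN
    have h2 := b.2.prefixSum_le le_rfl
    have h3 := neg_le_prefixSum b.1 n
    omega
  have ht : ∀ j, n < j → j ≤ N - 1 → b.1 (site N j) = true := by
    intro j hj hjN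
    refine hv.eq_true_of_dot_ne_zero h (by omega) ?_ (by omega) hjN
    by_contra hf
    rw [Bool.not_eq_true] at hf
    exact h (hv.dot_eq_zero_of_last_two hτ (by omega) hlast hf)
  have h1 := prefixSum_of_true (by omega : n ≤ N - 1) ht
  have h2 := b.2.prefixSum_le (by omega : N - 1 ≤ N)
  have hf := fun j => eq_false_of_prefixSum_le (b := b.1) (k := n) (j := j) (by omega)
  refine Subtype.ext (ext_site fun j hj hjN => ?_)
  rcases le_or_gt j n with hle | hgt
  · rw [hf j hj hle, bLast_false hodd hj (by omega)]
  · rcases hjN.lt_or_eq with hlt | rfl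
    · rw [ht j hgt (by omega), bLast_true hodd (by omega) (by omega)]
    · rw [hlast, bLast_last hodd]

theorem HasHead.eq_false {S : Type*} [CommRing S] {n : ℕ} {w : Str N → S} (hw : HasHead n w)
    {ε : Str N} (hε : w ε ≠ 0) {j : ℕ} (hj : 1 ≤ j) (hjn : j ≤ n) : ε (site N j) = false := by
  by_contra h
  rw [Bool.not_eq_false] at h
  exact hε (hw j hj hjn ε h)

/-- A string in the support of a basis vector with nested arcs that agrees with the index of this
vector at the left ends of the arcs agrees with it on all arcs. -/
theorem eq_of_nested {p : Params K} {b : Str N} {n k : ℕ} (hk : k ≤ N) (hkn : k ≤ 2 * n)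
    (h1 : ∀ j, 1 ≤ j → j ≤ n → b (site N j) = false)
    (h2 : ∀ j, n < j → j ≤ k → b (site N j) = true) {ε : Str N} (hf : ∀ j, 1 ≤ j → j ≤ n → ε (site N j) = false)
    (hb : klBasis p b ε ≠ 0) {j : ℕ} (hj : 1 ≤ j) (hjk : j ≤ k) : ε (site N j) = b (site N j) := by
  rcases le_or_gt j n with hle | hgt
  · rw [hf j hj hle, h1 j hj hle]
  · rw [h2 j hgt hjk]
    by_contra h
    rw [Bool.not_eq_true] at h
    apply hb
    refine klBasis_eq_zero_of_arc p (isArc_of_nested hk h1 h2 (i := 2 * n + 1 - j) (by omega)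
      (by omega) hgt hjk (by omega)) ?_
    rw [h, hf _ (by omega) (by omega)]

/-- The head fixes the left ends of the nested arcs to $-$, and then the arcs fix the right ends to
$+$, so only the string $b_0$ itself contributes. -/
theorem dot_b0 (p : Params K) :
    dot p (productFunctional (N := N) p (p.qN : K)⁻¹ ((N + 1) / 2)) (b0 N).1 = 1 := by
  have := NeZero.one_le (n := N)
  rw [dot, Fintype.sum_eq_single (b0 N).1]
  · rw [klBasis_self, productFunctional_eq_one p _ (fun j => b0_false) fun j => b0_true, one_smul]
  · intro ε hε
    by_contra h
    apply hε
    rw [smul_eq_mul, mul_eq_zero, not_or] at h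
    exact ext_site fun j hj hjN => eq_of_nested le_rfl (by omega) (fun j => b0_false)
      (fun j => b0_true) (fun j => (hasHead_productFunctional p _ (by omega)).eq_false h.2) h.1 hj hjN

theorem dot_bLast (p : Params K) (hN : Odd N) {S : Type*} [CommRing S] [Algebra K S] (τ : S) :
    dot p (productFunctional (N := N) p τ ((N - 1) / 2)) (bLast N hN).1
      = (p.κN : K) • (τ - algebraMap K S (p.qN : K)⁻¹) := by
  have hodd := hN
  obtain ⟨n, hn⟩ := hN
  rw [(hasTail_productFunctional p τ _).dot_last (by omega) (bLast_last hodd),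
    Fintype.sum_eq_single (bLast N hodd).1]
  · rw [if_pos (bLast_last hodd), klBasis_self, one_smul, productFunctional_eq_one, mul_one]
    · intro j hj hjn
      rw [Function.update_of_ne (site_ne hj (by omega) (by omega) le_rfl (by omega)),
        bLast_false hodd hj hjn]
    · intro j hj hjN
      rcases hjN.lt_or_eq with hlt | rfl
      · rw [Function.update_of_ne (site_ne (by omega) hjN (by omega) le_rfl (by omega)),
          bLast_true hodd hj (by omega)]
      · simp
  · intro ε hε
    split_ifs with hl
    · by_contra h
      apply hε
      have hw : productFunctional p τ ((N - 1) / 2) (Function.update ε (site N N) true) ≠ 0 :=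
        fun h0 => h (by rw [h0, mul_zero, smul_zero])
      have hf : ∀ j, 1 ≤ j → j ≤ (N - 1) / 2 → ε (site N j) = false := by
        intro j hj hjn
        have := (hasHead_productFunctional p τ (by omega)).eq_false hw hj hjn
        rwa [Function.update_of_ne (site_ne hj (by omega) (by omega) le_rfl (by omega))] at this
      have hb : klBasis p (bLast N hodd).1 ε ≠ 0 := fun h0 => h (by rw [h0, zero_smul])
      refine ext_site fun j hj hjN => ?_
      rcases hjN.lt_or_eq with hlt | rfl
      · exact eq_of_nested (by omega : N - 1 ≤ N) (by omega) (fun j => bLast_false hodd)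
          (fun j => bLast_true hodd) hf hb hj (by omega)
      · rw [hl, bLast_last hodd]
    · rfl

end Dual

/-! ### Eigenvalues of the two components, with natural exponents -/

section Components

variable {K : Type*} [Field K] {N : ℕ} [NeZero N]

theorem Yhat_b0 {p : Params K} {Ψ : Ballot N → RatFn K N} (hΨ : IsSolution p Ψ) (hN : 2 ≤ N) :
    (∀ i, (N + 1) / 2 < i → i ≤ N → Yhat p N i (Ψ (b0 N))
      = (-(p.q0 : K) * ((p.q : K)⁻¹ ^ (2 * (N - i)) * (p.qN : K)⁻¹)) • Ψ (b0 N)) ∧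
    (∀ i, 1 ≤ i → i ≤ (N + 1) / 2 → Yhat p N i (Ψ (b0 N))
      = (p.q0 * ((p.q : K)⁻¹ ^ (2 * ((N + 1) / 2 - i)) * p.qN)) • Ψ (b0 N)) := by
  have hτ : ((p.qN : K)⁻¹ - algebraMap K K (p.qN : K)⁻¹)
      * ((p.qN : K)⁻¹ + algebraMap K K p.qN) = 0 := by simp
  have hw := hasTail_productFunctional (N := N) p (p.qN : K)⁻¹ ((N + 1) / 2)
  have hv := fun v : Str N → K => dot_eq_zero_of_ne_b0 (p := p) hN (v := v)
  have hℓ : (LinearMap.id : K →ₗ[K] K)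
      (dot p (productFunctional p (p.qN : K)⁻¹ ((N + 1) / 2)) (b0 N).1) = 1 := dot_b0 p
  have hτ₀ : (LinearMap.id : K →ₗ[K] K) ((p.qN : K)⁻¹
      * dot p (productFunctional p (p.qN : K)⁻¹ ((N + 1) / 2)) (b0 N).1) = (p.qN : K)⁻¹ := by
    rw [dot_b0, mul_one, LinearMap.id_apply]
  constructor
  · intro i hi hiN
    exact Yhat_eigen_tail hΨ hτ hw hv hℓ hτ₀ hi hiN
  · intro i h1 hi
    rw [Yhat_eigen_head hΨ hτ hw (hasHead_productFunctional p _ (by omega)) hv hℓ hτ₀ (by omega)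
      (b0_false (by omega) le_rfl) (b0_true (by omega) (by omega)) h1 hi, sub_sub_cancel]

theorem Yhat_bLast {p : Params K} {Ψ : Ballot N → RatFn K N} (hΨ : IsSolution p Ψ) (hN : Odd N) :
    (∀ i, (N - 1) / 2 < i → i ≤ N → Yhat p N i (Ψ (bLast N hN))
      = (-(p.q0 : K) * ((p.q : K)⁻¹ ^ (2 * (N - i)) * -(p.qN : K))) • Ψ (bLast N hN)) ∧
    (∀ i, 1 ≤ i → i ≤ (N - 1) / 2 → Yhat p N i (Ψ (bLast N hN))
      = (p.q0 * ((p.q : K)⁻¹ ^ (2 * ((N - 1) / 2 - i)) * -(p.qN : K)⁻¹)) • Ψ (bLast N hN)) := by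
  have hodd := hN
  obtain ⟨n, hn⟩ := hN
  -- The generic root, with $\tau^2=1+(q_N^{-1}-q_N)\tau$. The value at the basis vector is
  -- $\kappa_N(\tau-q_N^{-1})$, so $\kappa_N^{-1}$ times the coefficient of $\tau$ normalizes it to
  -- $1$.
  let τ : QuadraticAlgebra K 1 ((p.qN : K)⁻¹ - p.qN) := ⟨0, 1⟩
  let ℓ : QuadraticAlgebra K 1 ((p.qN : K)⁻¹ - p.qN) →ₗ[K] K :=
    (p.κN : K)⁻¹ • QuadraticAlgebra.imₗ 1 ((p.qN : K)⁻¹ - p.qN)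
  have hℓ_apply : ∀ x, ℓ x = (p.κN : K)⁻¹ * x.im := fun _ => rfl
  have hτ : (τ - algebraMap K _ (p.qN : K)⁻¹) * (τ + algebraMap K _ p.qN) = 0 := by
    ext <;> simp [τ]
  have hw := hasTail_productFunctional (N := N) p τ ((N - 1) / 2)
  have hv := fun v => dot_eq_zero_of_ne_bLast (p := p) hodd hτ (v := v)
  have hℓ : ℓ (dot p (productFunctional p τ ((N - 1) / 2)) (bLast N hodd).1) = 1 := by
    rw [dot_bLast, hℓ_apply]
    simp [τ]
  -- By the quadratic relation, $\tau(\tau-q_N^{-1})=-q_N(\tau-q_N^{-1})$: this vector selects the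
  -- root $-q_N$.
  have hτ₀ : ℓ (τ * dot p (productFunctional p τ ((N - 1) / 2)) (bLast N hodd).1)
      = -(p.qN : K) := by
    rw [dot_bLast, hℓ_apply]
    simp [τ]
    field_simp
    ring
  constructor
  · intro i hi hiN
    exact Yhat_eigen_tail hΨ hτ hw hv hℓ hτ₀ hi hiN
  · intro i h1 hi
    rw [Yhat_eigen_head hΨ hτ hw (hasHead_productFunctional p _ (by omega)) hv hℓ hτ₀ (by omega)
      (bLast_false hodd (by omega) le_rfl) (bLast_true hodd (by omega) (by omega)) h1 hi]
    congr 3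
    ring

theorem inv_pow_eq_zpow (a : K) {k : ℕ} {e : ℤ} (h : e = -(k : ℤ)) : a⁻¹ ^ k = a ^ e := by
  rw [h, zpow_neg, zpow_natCast, inv_pow]

end Components

end OneBoundaryQKZ

/-! ### The eigenvalues with integer exponents -/

theorem mainTheorem6 {K : Type*} [Field K] (N : ℕ) [NeZero N]
    (p : OneBoundaryQKZ.Params K)
    (Ψ : OneBoundaryQKZ.Ballot N → OneBoundaryQKZ.RatFn K N)
    (hΨ : OneBoundaryQKZ.IsSolution p Ψ) :
    (∀ hN : Odd N,
      (∀ i : ℕ, 1 ≤ i → i ≤ (N + 1) / 2 →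
        OneBoundaryQKZ.Yhat p N i (Ψ (OneBoundaryQKZ.b0 N))
          = ((p.q : K) ^ (-((N : ℤ) + 1 - 2 * i)) * p.q0 * p.qN)
              • Ψ (OneBoundaryQKZ.b0 N)) ∧
      (∀ i : ℕ, (N + 3) / 2 ≤ i → i ≤ N →
        OneBoundaryQKZ.Yhat p N i (Ψ (OneBoundaryQKZ.b0 N))
          = (-(p.q : K) ^ (-2 * ((N : ℤ) - i)) * p.q0 * (p.qN : K)⁻¹)
              • Ψ (OneBoundaryQKZ.b0 N)) ∧
      (∀ i : ℕ, 1 ≤ i → i ≤ (N - 1) / 2 →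
        OneBoundaryQKZ.Yhat p N i (Ψ (OneBoundaryQKZ.bLast N hN))
          = (-(p.q : K) ^ (-((N : ℤ) - 1 - 2 * i)) * p.q0 * (p.qN : K)⁻¹)
              • Ψ (OneBoundaryQKZ.bLast N hN)) ∧
      (∀ i : ℕ, (N + 1) / 2 ≤ i → i ≤ N →
        OneBoundaryQKZ.Yhat p N i (Ψ (OneBoundaryQKZ.bLast N hN))
          = ((p.q : K) ^ (-2 * ((N : ℤ) - i)) * p.q0 * p.qN)
              • Ψ (OneBoundaryQKZ.bLast N hN))) ∧
    (Even N →
      (∀ i : ℕ, 1 ≤ i → i ≤ N / 2 →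
        OneBoundaryQKZ.Yhat p N i (Ψ (OneBoundaryQKZ.b0 N))
          = ((p.q : K) ^ (-((N : ℤ) - 2 * i)) * p.q0 * p.qN)
              • Ψ (OneBoundaryQKZ.b0 N)) ∧
      (∀ i : ℕ, N / 2 + 1 ≤ i → i ≤ N →
        OneBoundaryQKZ.Yhat p N i (Ψ (OneBoundaryQKZ.b0 N))
          = (-(p.q : K) ^ (-2 * ((N : ℤ) - i)) * p.q0 * (p.qN : K)⁻¹)
              • Ψ (OneBoundaryQKZ.b0 N))) := by
  open OneBoundaryQKZ in
  refine ⟨fun hN => ⟨fun i h1 hi => ?_, fun i h1 hi => ?_, fun i h1 hi => ?_, fun i h1 hi => ?_⟩,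
    fun hN => ⟨fun i h1 hi => ?_, fun i h1 hi => ?_⟩⟩
  · obtain ⟨n, hn⟩ := id hN
    -- For $N=1$ the functional for $b_0$ has an empty tail and `Yhat_b0` does not apply. Both
    -- strings are then the single letter $-$, and the other component gives the result.
    rcases Nat.eq_zero_or_pos n with rfl | hpos
    · have hb : b0 N = bLast N hN := Subtype.ext <| ext_site fun j hj hjN => by
        rw [b0_false hj (by omega), show j = N by omega, bLast_last]
      rw [hb, (Yhat_bLast hΨ hN).1 i (by omega) (by omega),
        inv_pow_eq_zpow (e := -((N : ℤ) + 1 - 2 * i)) _ (by omega)]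
      congr 1
      ring
    · rw [(Yhat_b0 hΨ (by omega)).2 i h1 hi,
        inv_pow_eq_zpow (e := -((N : ℤ) + 1 - 2 * i)) _ (by omega)]
      congr 1
      ring
  · rw [(Yhat_b0 hΨ (by omega)).1 i (by omega) hi,
      inv_pow_eq_zpow (e := -2 * ((N : ℤ) - i)) _ (by omega)]
    congr 1
    ring
  · obtain ⟨n, hn⟩ := id hN
    rw [(Yhat_bLast hΨ hN).2 i h1 hi,
      inv_pow_eq_zpow (e := -((N : ℤ) - 1 - 2 * i)) _ (by omega)]
    congr 1
    ring
  · obtain ⟨n, hn⟩ := id hN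
    rw [(Yhat_bLast hΨ hN).1 i (by omega) hi,
      inv_pow_eq_zpow (e := -2 * ((N : ℤ) - i)) _ (by omega)]
    congr 1
    ring
  · obtain ⟨n, hn⟩ := id hN
    rw [(Yhat_b0 hΨ (by omega)).2 i h1 (by omega),
      inv_pow_eq_zpow (e := -((N : ℤ) - 2 * i)) _ (by omega)]
    congr 1
    ring
  · obtain ⟨n, hn⟩ := id hN
    have := NeZero.ne N
    rw [(Yhat_b0 hΨ (by omega)).1 i (by omega) hi,
      inv_pow_eq_zpow (e := -2 * ((N : ℤ) - i)) _ (by omega)]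
    congr 1
    ring
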